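/- Consider $M\ge 1$ bosonic modes on Fock space with annihilation operators $a_1,\dots,a_M$, displacement operators $D(\vec\alpha)=\exp\sum_m(\alpha_m a_m^\dagger-\alpha_m^*a_m)$, parity $\Pi=\exp(-i\pi\sum_m a_m^\dagger a_m)$, and Wigner function $$W_\rho(\vec\alpha)=\Big(\frac{2}{\pi}\Big)^M\operatorname{tr}\big[\rho\,D(\vec\alpha)\,\Pi\,D(\vec\alpha)^\dagger\big].$$ The absolute Wigner volume of an $M$-mode state $\rho$ along the slice $\{\alpha\vec 1:\alpha\in\mathbb C\}$, $\vec 1=(1,\dots,1)$, is $$\mathcal V_{2D}(\rho;\mathbb C)=\Big(\frac{\pi}{2}\Big)^{M-1}\int_{\mathbb C}|W_\rho(\alpha\vec 1)|\,d^2\alpha\in[0,\infty].$$ Let $\mathcal U$ be a unitary $M\times M$ matrix with skew-Hermitian logarithm $\log\mathcal U$, and let $U_M=\exp\big(\sum_{i,j}(\log\mathcal U)_{ij}\,a_i^\dagger a_j\big)$ be the corresponding multiport beamsplitter. Suppose that for some complex numbers $c_{m,m'}$, $$\sqrt M\,U_M^\dagger a_mU_M=a_1+\sum_{m'\ne1}c_{m,m'}a_{m'}\qquad\text{for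 all }m$$ (as an identity on finite linear combinations of number states). For a one-mode state $\rho_1$ put $\mathcal U_M(\rho_1)=U_M\big(\rho_1\otimes(|0\rangle\langle0|)^{\otimes(M-1)}\big)U_M^\dagger$. Then the following hold. 1. For every one-mode state $\rho_1$, as an identity in $[0,\infty]$, $$\mathcal V_{2D}(\mathcal U_M(\rho_1);\mathbb C)=\frac1M\int_{\mathbb C}|W_{\rho_1}(\alpha)|\,d^2\alpha .$$ 2. $\mathcal U_M(|1\rangle\langle1|)=|W_M\rangle\langle W_M|$, where $|W_M\rangle=M^{-1/2}\big(|10\cdots0\rangle+|01\cdots0\rangle+\dots+|0\cdots01\rangle\big)$. Moreover, for every $M\ge 1$, $$\mathcal V_{2D}(|W_M\rangle\langle W_M|;\mathbb C)=\frac{4}{M\sqrt e}-\frac1M .$$ Consequently, for $M\ge2$, the state $|W_M\rangle$ is detected by the entanglement criterion $\mathcal V_{2D}(\rho;\mathbb C)>\frac{1}{2\sqrt{M-1}}$ along this slice if and only if $M\le6$. -/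

import Mathlib

open scoped ENNReal ComplexConjugate

noncomputable section

namespace BosonicModes

/-! ### Fock space of `M` bosonic modes -/

/-- The Hilbert space of `M` modes in the occupation-number representation, `ℓ²(ℕ^M)`. -/
abbrev Fock (M : ℕ) : Type := lp (fun _ : Fin M → ℕ => ℂ) 2

/-- The number state `|n₁, …, n_M⟩`. -/
def ket {M : ℕ} (n : Fin M → ℕ) : Fock M := lp.single 2 n (1 : ℂ)

/-- Finite linear combinations of number states (as formal combinations). -/
abbrev FinVec (M : ℕ) : Type := (Fin M → ℕ) →₀ ℂ

/-- A finite linear combination of number states, as a vector of the Hilbert space. -/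
def toFock {M : ℕ} : FinVec M →ₗ[ℂ] Fock M := Finsupp.linearCombination ℂ ket

/-- `a_m` on finite combinations of number states: `a_m |n⟩ = √n_m |n - 1_m⟩`. -/
def annFin {M : ℕ} (m : Fin M) : FinVec M →ₗ[ℂ] FinVec M :=
  Finsupp.linearCombination ℂ fun n =>
    Finsupp.single (n - Pi.single m 1) ((Real.sqrt (n m) : ℝ) : ℂ)

/-- `a_m†` on finite combinations of number states: `a_m† |n⟩ = √(n_m + 1) |n + 1_m⟩`. -/
def creFin {M : ℕ} (m : Fin M) : FinVec M →ₗ[ℂ] FinVec M :=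
  Finsupp.linearCombination ℂ fun n =>
    Finsupp.single (n + Pi.single m 1) ((Real.sqrt (n m + 1) : ℝ) : ℂ)

/-- The (unbounded) annihilation operator `a_m` on its maximal domain
`{ψ | ∑ n_m |ψ(n)|² < ∞}`, acting by `(a_m ψ)(n) = √(n_m + 1) ψ(n + 1_m)`. -/
def annihilation {M : ℕ} (m : Fin M) : Fock M →ₗ.[ℂ] Fock M where
  domain :=
    { carrier := {ψ | Memℓp (fun n : Fin M → ℕ =>
        ((Real.sqrt (n m + 1) : ℝ) : ℂ) * ψ (n + Pi.single m 1)) 2}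
      add_mem' := by
        intro ψ φ hψ hφ
        have h := Memℓp.add hψ hφ
        refine (congrArg (fun f => Memℓp f 2) ?_).mp h
        funext n
        simp [mul_add]
      zero_mem' := by
        have h := zero_memℓp (E := fun _ : Fin M → ℕ => ℂ) (p := 2)
        refine (congrArg (fun f => Memℓp f 2) ?_).mp h
        funext n
        simp
      smul_mem' := by
        intro c ψ hψ
        have h := Memℓp.const_smul hψ c
        refine (congrArg (fun f => Memℓp f 2) ?_).mp h
        funext n
        simp [mul_left_comm] }
  toFun :=
    { toFun := fun ψ => ⟨fun n : Fin M → ℕ =>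
        ((Real.sqrt (n m + 1) : ℝ) : ℂ) * ψ.1 (n + Pi.single m 1), ψ.2⟩
      map_add' := by
        intro ψ φ
        ext n
        exact mul_add _ _ _
      map_smul' := by
        intro c ψ
        ext n
        simp [mul_left_comm] }

/-! ### Exponentials of skew-symmetric operators on finite combinations of number states -/

lemma inner_ket {M : ℕ} (n n' : Fin M → ℕ) :
    inner ℂ (ket n) (ket n') = if n = n' then (1 : ℂ) else 0 := by
  classical
  unfold ket
  rw [lp.inner_single_left]
  by_cases h : n = n'
  · subst h; simp
  · simp [h, lp.single_apply]

lemma norm_ket {M : ℕ} (n : Fin M → ℕ) : ‖ket n‖ = 1 := by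
  have h : inner ℂ (ket n) (ket n) = (1 : ℂ) := by rw [inner_ket, if_pos rfl]
  have h2 : ‖ket n‖ ^ 2 = 1 := by rw [← inner_self_eq_norm_sq (𝕜 := ℂ), h]; simp
  nlinarith [norm_nonneg (ket n)]

lemma ket_orthonormal {M : ℕ} : Orthonormal ℂ (ket (M := M)) := by
  classical
  rw [orthonormal_iff_ite]
  intro n n'
  rw [inner_ket]

@[simp] lemma toFock_single {M : ℕ} (n : Fin M → ℕ) (c : ℂ) :
    toFock (Finsupp.single n c) = c • ket n := by
  simp [toFock]

@[simp] lemma annFin_single {M : ℕ} (m : Fin M) (n : Fin M → ℕ) :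
    annFin m (Finsupp.single n 1) =
      ((Real.sqrt (n m) : ℝ) : ℂ) • Finsupp.single (n - Pi.single m 1) 1 := by
  simp [annFin]

@[simp] lemma creFin_single {M : ℕ} (m : Fin M) (n : Fin M → ℕ) :
    creFin m (Finsupp.single n 1) =
      ((Real.sqrt (n m + 1) : ℝ) : ℂ) • Finsupp.single (n + Pi.single m 1) 1 := by
  simp [creFin]

/-- `X` is skew-symmetric and every number state is an analytic vector of infinite radius. -/
structure IsExpGenerator {M : ℕ} (X : FinVec M →ₗ[ℂ] FinVec M) : Prop where
  skew : ∀ f g, inner ℂ (toFock (X f)) (toFock g) = -inner ℂ (toFock f) (toFock (X g))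
  summable : ∀ n : Fin M → ℕ,
    Summable fun k : ℕ => ‖((k.factorial : ℂ)⁻¹) • toFock ((X ^ k) (Finsupp.single n 1))‖

/-- `e^X |n⟩ = ∑ₖ X^k |n⟩ / k!`. -/
def expKet {M : ℕ} (X : FinVec M →ₗ[ℂ] FinVec M) (n : Fin M → ℕ) : Fock M :=
  ∑' k : ℕ, ((k.factorial : ℂ)⁻¹) • toFock ((X ^ k) (Finsupp.single n 1))

lemma skew_pow {M : ℕ} {X : FinVec M →ₗ[ℂ] FinVec M}
    (skew : ∀ f g, inner ℂ (toFock (X f)) (toFock g) = -inner ℂ (toFock f) (toFock (X g)))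
    (j : ℕ) : ∀ f g, inner ℂ (toFock ((X ^ j) f)) (toFock g) =
      (-1) ^ j * inner ℂ (toFock f) (toFock ((X ^ j) g)) := by
  induction j with
  | zero => intro f g; simp
  | succ j ih =>
    intro f g
    rw [pow_succ', Module.End.mul_apply, skew, ih, ← Module.End.mul_apply, ← pow_succ, pow_succ']
    ring

lemma antidiagonal_sum (n : ℕ) :
    ∑ p ∈ Finset.HasAntidiagonal.antidiagonal n,
      ((p.1.factorial : ℂ)⁻¹) * ((p.2.factorial : ℂ)⁻¹) * (-1) ^ p.1 = if n = 0 then 1 else 0 := by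
  have h := (Commute.all (-1 : ℂ) 1).add_pow' n
  have e : ∀ p ∈ Finset.HasAntidiagonal.antidiagonal n,
      ((p.1.factorial : ℂ)⁻¹) * ((p.2.factorial : ℂ)⁻¹) * (-1) ^ p.1 =
      ((n.factorial : ℂ)⁻¹) * (n.choose p.1 • ((-1 : ℂ) ^ p.1 * 1 ^ p.2)) := by
    intro p hp
    rw [Finset.HasAntidiagonal.mem_antidiagonal] at hp
    have hc : ((n.choose p.1 : ℕ) : ℂ) * (p.1.factorial : ℂ) * (p.2.factorial : ℂ)
        = (n.factorial : ℂ) := by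
      have := Nat.add_choose_mul_factorial_mul_factorial p.1 p.2
      rw [← Nat.choose_symm_add, hp] at this
      exact_mod_cast this
    have h1 : (p.1.factorial : ℂ) ≠ 0 := by exact_mod_cast p.1.factorial_ne_zero
    have h2 : (p.2.factorial : ℂ) ≠ 0 := by exact_mod_cast p.2.factorial_ne_zero
    have h3 : (n.factorial : ℂ) ≠ 0 := by exact_mod_cast n.factorial_ne_zero
    rw [nsmul_eq_mul, one_pow, mul_one]
    field_simp
    rw [← hc]
    ring
  rw [Finset.sum_congr rfl e, ← Finset.mul_sum, ← h]
  by_cases h0 : n = 0 <;> simp [h0]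

lemma inner_expKet {M : ℕ} {X : FinVec M →ₗ[ℂ] FinVec M} (hX : IsExpGenerator X)
    (n n' : Fin M → ℕ) : inner ℂ (expKet X n) (expKet X n') = inner ℂ (ket n) (ket n') := by
  set x : ℕ → Fock M := fun k => ((k.factorial : ℂ)⁻¹) • toFock ((X ^ k) (Finsupp.single n 1))
    with hx
  set y : ℕ → Fock M := fun k => ((k.factorial : ℂ)⁻¹) • toFock ((X ^ k) (Finsupp.single n' 1))
    with hy
  have sx : Summable fun k => ‖x k‖ := hX.summable n
  have sy : Summable fun k => ‖y k‖ := hX.summable n'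
  have sF : Summable fun p : ℕ × ℕ => inner ℂ (x p.1) (y p.2) :=
    Summable.of_norm_bounded (sx.mul_of_nonneg sy (fun _ => norm_nonneg _)
      (fun _ => norm_nonneg _)) (fun p => norm_inner_le_norm _ _)
  have hL : inner ℂ (expKet X n) (expKet X n') = ∑' p : ℕ × ℕ, inner ℂ (x p.1) (y p.2) := by
    rw [sF.tsum_prod]
    have h1 : ∀ j, ∑' k, inner ℂ (x j) (y k) = inner ℂ (x j) (expKet X n') := fun j =>
      ((innerSL ℂ (x j)).hasSum sy.of_norm.hasSum).tsum_eq
    simp_rw [h1]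
    have h2 : HasSum (fun j => inner ℂ (expKet X n') (x j))
        (inner ℂ (expKet X n') (expKet X n)) :=
      (innerSL ℂ (expKet X n')).hasSum sx.of_norm.hasSum
    have h3 := (Complex.conjCLE : ℂ →L[ℝ] ℂ).hasSum h2
    have h4 := h3.tsum_eq
    simp only [ContinuousLinearEquiv.coe_coe, Complex.conjCLE_apply, inner_conj_symm] at h4
    exact h4.symm
  rw [hL, ← Finset.HasAntidiagonal.sigmaAntidiagonalEquivProd.tsum_eq]
  have sG : Summable fun c : (Σ N : ℕ, Finset.HasAntidiagonal.antidiagonal N) =>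
      inner ℂ (x (Finset.HasAntidiagonal.sigmaAntidiagonalEquivProd c).1)
        (y (Finset.HasAntidiagonal.sigmaAntidiagonalEquivProd c).2) :=
    Finset.HasAntidiagonal.sigmaAntidiagonalEquivProd.summable_iff.mpr sF
  rw [sG.tsum_sigma' (fun _ => (hasSum_fintype _).summable)]
  have hterm : ∀ N : ℕ, (∑' c : Finset.HasAntidiagonal.antidiagonal N,
      inner ℂ (x (Finset.HasAntidiagonal.sigmaAntidiagonalEquivProd ⟨N, c⟩).1)
        (y (Finset.HasAntidiagonal.sigmaAntidiagonalEquivProd ⟨N, c⟩).2)) =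
      if N = 0 then inner ℂ (ket n) (ket n') else (0 : ℂ) := by
    intro N
    rw [tsum_fintype]
    simp only [Finset.HasAntidiagonal.sigmaAntidiagonalEquivProd_apply]
    rw [Finset.sum_coe_sort (Finset.HasAntidiagonal.antidiagonal N) fun p : ℕ × ℕ => inner ℂ (x p.1) (y p.2)]
    have e : ∀ p ∈ Finset.HasAntidiagonal.antidiagonal N, inner ℂ (x p.1) (y p.2) =
        (((p.1.factorial : ℂ)⁻¹) * ((p.2.factorial : ℂ)⁻¹) * (-1) ^ p.1) *
          inner ℂ (toFock (Finsupp.single n 1)) (toFock ((X ^ N) (Finsupp.single n' 1))) := by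
      intro p hp
      rw [Finset.HasAntidiagonal.mem_antidiagonal] at hp
      simp only [hx, hy, inner_smul_left, inner_smul_right]
      rw [skew_pow hX.skew, ← Module.End.mul_apply, ← pow_add, hp]
      simp
      ring
    rw [Finset.sum_congr rfl e, ← Finset.sum_mul, antidiagonal_sum]
    by_cases h0 : N = 0 <;> simp [h0]
  simp_rw [hterm]
  rw [tsum_ite_eq]

lemma expKet_orthonormal {M : ℕ} {X : FinVec M →ₗ[ℂ] FinVec M} (hX : IsExpGenerator X) :
    Orthonormal ℂ (expKet X) := by
  classical
  rw [orthonormal_iff_ite]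
  intro n n'
  rw [inner_expKet hX, inner_ket]

/-- The operator `e^X` on the Hilbert space: the continuous extension of
`|n⟩ ↦ ∑ₖ X^k |n⟩ / k!`. -/
def expOp {M : ℕ} (X : FinVec M →ₗ[ℂ] FinVec M) (hX : IsExpGenerator X) :
    Fock M →L[ℂ] Fock M :=
  (expKet_orthonormal hX).orthogonalFamily.linearIsometry.toContinuousLinearMap

lemma expOp_ket {M : ℕ} (X : FinVec M →ₗ[ℂ] FinVec M) (hX : IsExpGenerator X)
    (n : Fin M → ℕ) : expOp X hX (ket n) = expKet X n := by
  classical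
  unfold expOp ket
  exact ((expKet_orthonormal hX).orthogonalFamily.linearIsometry_apply_single (1 : ℂ)).trans
    (by simp)

/-! ### Displacements, multiport beamsplitters and parity -/

/-- `∑_m (α_m a_m† - α_m^* a_m)`. -/
def displacementGen {M : ℕ} (α : Fin M → ℂ) : FinVec M →ₗ[ℂ] FinVec M :=
  ∑ m, (α m • creFin m - conj (α m) • annFin m)

/-- `∑_{i,j} L_{ij} a_i† a_j`. -/
def bilinearGen {M : ℕ} (L : Matrix (Fin M) (Fin M) ℂ) : FinVec M →ₗ[ℂ] FinVec M :=
  ∑ i, ∑ j, L i j • (creFin i ∘ₗ annFin j)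

lemma cre_adjoint_ann {M : ℕ} (m : Fin M) (f g : FinVec M) :
    inner ℂ (toFock (creFin m f)) (toFock g) = inner ℂ (toFock f) (toFock (annFin m g)) := by
  induction f using Finsupp.induction_linear with
  | zero => simp
  | add f₁ f₂ h₁ h₂ => simp only [map_add, inner_add_left, h₁, h₂]
  | single n c =>
    induction g using Finsupp.induction_linear with
    | zero => simp
    | add g₁ g₂ h₁ h₂ => simp only [map_add, inner_add_right, h₁, h₂]
    | single n' c' =>
      rw [← mul_one c, ← mul_one c', ← smul_eq_mul, ← smul_eq_mul, ← Finsupp.smul_single,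
        ← Finsupp.smul_single]
      simp only [map_smul, creFin_single, annFin_single, toFock_single, inner_smul_left,
        inner_smul_right, one_smul, inner_ket]
      by_cases h : n + Pi.single m 1 = n'
      · subst h
        have h2 : n + Pi.single m 1 - Pi.single m 1 = n := by
          funext i; simp
        simp [h2]
        left; ring
      · by_cases h3 : n' m = 0
        · simp [h3, h]
        · have h2 : n ≠ n' - Pi.single m 1 := by
            rintro rfl
            apply h
            funext i
            by_cases hi : i = m
            · subst hi; simp; omega
            · simp [hi]
          simp [h, h2]

lemma ann_adjoint_cre {M : ℕ} (m : Fin M) (f g : FinVec M) :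
    inner ℂ (toFock (annFin m f)) (toFock g) = inner ℂ (toFock f) (toFock (creFin m g)) := by
  rw [← inner_conj_symm, ← cre_adjoint_ann, inner_conj_symm]

lemma displacementGen_skew {M : ℕ} (α : Fin M → ℂ) (f g : FinVec M) :
    inner ℂ (toFock (displacementGen α f)) (toFock g) =
      -inner ℂ (toFock f) (toFock (displacementGen α g)) := by
  simp only [displacementGen, LinearMap.sum_apply, LinearMap.sub_apply, LinearMap.smul_apply,
    map_sum, map_sub, map_smul, sum_inner, inner_sum, inner_sub_left, inner_sub_right,
    inner_smul_left, inner_smul_right, cre_adjoint_ann, ann_adjoint_cre, Complex.conj_conj]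
  rw [← Finset.sum_neg_distrib]
  exact Finset.sum_congr rfl fun m _ => by ring

lemma bilinearGen_skew {M : ℕ} (L : Matrix (Fin M) (Fin M) ℂ) (hL : L.conjTranspose = -L)
    (f g : FinVec M) :
    inner ℂ (toFock (bilinearGen L f)) (toFock g) =
      -inner ℂ (toFock f) (toFock (bilinearGen L g)) := by
  simp only [bilinearGen, LinearMap.sum_apply, LinearMap.smul_apply, LinearMap.comp_apply,
    map_sum, map_smul, sum_inner, inner_sum, inner_smul_left, inner_smul_right,
    cre_adjoint_ann, ann_adjoint_cre]
  rw [Finset.sum_comm, ← Finset.sum_neg_distrib]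
  refine Finset.sum_congr rfl fun i _ => ?_
  rw [← Finset.sum_neg_distrib]
  refine Finset.sum_congr rfl fun j _ => ?_
  have h := congrFun (congrFun hL i) j
  simp only [Matrix.conjTranspose_apply, Matrix.neg_apply] at h
  rw [starRingEnd_apply, h]
  ring

lemma le_total {M : ℕ} (n : Fin M → ℕ) (m : Fin M) : n m ≤ ∑ i, n i :=
  Finset.single_le_sum (f := n) (fun _ _ => Nat.zero_le _) (Finset.mem_univ m)

lemma total_add {M : ℕ} (n : Fin M → ℕ) (m : Fin M) :
    ∑ i, (n + Pi.single m 1 : Fin M → ℕ) i = ∑ i, n i + 1 := by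
  simp [Finset.sum_add_distrib]

lemma total_sub {M : ℕ} (n : Fin M → ℕ) (m : Fin M) :
    ∑ i, (n - Pi.single m 1 : Fin M → ℕ) i ≤ ∑ i, n i :=
  Finset.sum_le_sum fun i _ => by simp

lemma displacementGen_bound {M : ℕ} (α : Fin M → ℂ) (k : ℕ) :
    ∀ (N : ℕ) (n : Fin M → ℕ), ∑ i, n i ≤ N →
      ‖toFock ((displacementGen α ^ k) (Finsupp.single n 1))‖ ≤
        (∑ m, 2 * ‖α m‖) ^ k * Real.sqrt ((N + 1).ascFactorial k) := by
  induction k with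
  | zero => intro N n _; simp [norm_ket]
  | succ k ih =>
    intro N n hn
    set C := ∑ m, 2 * ‖α m‖ with hC
    set B := C ^ k * Real.sqrt ((N + 1 + 1).ascFactorial k) with hB
    have hB0 : 0 ≤ B := by positivity
    rw [pow_succ, Module.End.mul_apply]
    simp only [displacementGen, LinearMap.sum_apply, LinearMap.sub_apply, LinearMap.smul_apply,
      creFin_single, annFin_single]
    rw [← displacementGen, map_sum, map_sum]
    have hs : Real.sqrt ((N + 1).ascFactorial (k + 1)) =
        Real.sqrt (N + 1) * Real.sqrt ((N + 1 + 1).ascFactorial k) := by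
      rw [← Real.sqrt_mul (by positivity)]
      congr 1
      have h := Nat.succ_ascFactorial (N + 1) k
      rw [Nat.ascFactorial_succ, ← h]
      push_cast
      ring
    have hgoal : C ^ (k + 1) * Real.sqrt ((N + 1).ascFactorial (k + 1)) =
        ∑ m, 2 * ‖α m‖ * (Real.sqrt (N + 1) * B) := by
      rw [← Finset.sum_mul, ← hC, hs, hB]; ring
    rw [hgoal]
    refine (norm_sum_le _ _).trans (Finset.sum_le_sum fun m _ => ?_)
    have hnm : (n m : ℝ) ≤ N := by exact_mod_cast (le_total n m).trans hn
    have h1 := ih (N + 1) (n + Pi.single m 1) (by rw [total_add]; omega)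
    have h2 := ih (N + 1) (n - Pi.single m 1) ((total_sub n m).trans (by omega))
    have s1 : Real.sqrt (n m + 1) ≤ Real.sqrt (N + 1) := Real.sqrt_le_sqrt (by linarith)
    have s2 : Real.sqrt (n m) ≤ Real.sqrt (N + 1) := Real.sqrt_le_sqrt (by linarith)
    simp only [map_sub, map_smul]
    refine (norm_sub_le _ _).trans ?_
    simp only [norm_smul, Complex.norm_real, Real.norm_eq_abs, abs_of_nonneg (Real.sqrt_nonneg _),
      RCLike.norm_conj]
    have t1 := mul_le_mul s1 h1 (norm_nonneg _) (Real.sqrt_nonneg _)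
    have t2 := mul_le_mul s2 h2 (norm_nonneg _) (Real.sqrt_nonneg _)
    have t3 := mul_le_mul_of_nonneg_left t1 (norm_nonneg (α m))
    have t4 := mul_le_mul_of_nonneg_left t2 (norm_nonneg (α m))
    calc _ ≤ ‖α m‖ * (Real.sqrt (N + 1) * B) + ‖α m‖ * (Real.sqrt (N + 1) * B) :=
          add_le_add t3 t4
      _ = _ := by ring

lemma bilinearGen_bound {M : ℕ} (L : Matrix (Fin M) (Fin M) ℂ) (N : ℕ) (k : ℕ) :
    ∀ n : Fin M → ℕ, ∑ i, n i ≤ N →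
      ‖toFock ((bilinearGen L ^ k) (Finsupp.single n 1))‖ ≤
        ((∑ i, ∑ j, ‖L i j‖) * (N + 1)) ^ k := by
  induction k with
  | zero => intro n _; simp [norm_ket]
  | succ k ih =>
    intro n hn
    set C := ∑ i, ∑ j, ‖L i j‖ with hC
    rw [pow_succ, Module.End.mul_apply]
    simp only [bilinearGen, LinearMap.sum_apply, LinearMap.smul_apply, LinearMap.comp_apply,
      annFin_single, map_smul, creFin_single]
    rw [← bilinearGen]
    simp only [map_sum, map_smul]
    have hgoal : (C * (N + 1)) ^ (k + 1) =
        ∑ i, ∑ j, ‖L i j‖ * ((N + 1) * (C * (N + 1)) ^ k) := by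
      simp_rw [← Finset.sum_mul]
      rw [← hC]; ring
    rw [hgoal]
    refine (norm_sum_le _ _).trans (Finset.sum_le_sum fun i _ => ?_)
    refine (norm_sum_le _ _).trans (Finset.sum_le_sum fun j _ => ?_)
    simp only [norm_smul, Complex.norm_real, Real.norm_eq_abs, abs_of_nonneg (Real.sqrt_nonneg _)]
    refine mul_le_mul_of_nonneg_left ?_ (norm_nonneg _)
    by_cases hj : n j = 0
    · simp only [hj, Nat.cast_zero, Real.sqrt_zero, zero_mul]
      positivity
    · have htot : ∑ l, (n - Pi.single j 1 + Pi.single i 1 : Fin M → ℕ) l ≤ N := by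
        rw [total_add]
        have hback : (n - Pi.single j 1) + Pi.single j 1 = n := by
          funext l
          by_cases hl : l = j
          · subst hl; simp; omega
          · simp [hl]
        have := total_add (n - Pi.single j 1) j
        rw [hback] at this
        omega
      have h1 := ih _ htot
      have hnj : (n j : ℝ) ≤ N := by exact_mod_cast (le_total n j).trans hn
      have hni : ((n - Pi.single j 1 : Fin M → ℕ) i : ℝ) ≤ N := by
        exact_mod_cast ((le_total _ i).trans (total_sub n j)).trans hn
      have s1 : Real.sqrt (n j) ≤ Real.sqrt (N + 1) := Real.sqrt_le_sqrt (by linarith)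
      have s2 : Real.sqrt ((n - Pi.single j 1 : Fin M → ℕ) i + 1) ≤ Real.sqrt (N + 1) :=
        Real.sqrt_le_sqrt (by linarith)
      have hN : Real.sqrt (N + 1) * Real.sqrt (N + 1) = N + 1 :=
        Real.mul_self_sqrt (by positivity)
      calc _ ≤ Real.sqrt (N + 1) * (Real.sqrt (N + 1) * (C * (N + 1)) ^ k) :=
            mul_le_mul s1 (mul_le_mul s2 h1 (norm_nonneg _) (Real.sqrt_nonneg _))
              (by positivity) (Real.sqrt_nonneg _)
        _ = _ := by rw [← mul_assoc, hN]

lemma summable_pow_div_sqrt_factorial (x : ℝ) :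
    Summable fun k : ℕ => x ^ k / Real.sqrt k.factorial := by
  have h1 : Summable fun k : ℕ => (4 * x ^ 2) ^ k / (k.factorial : ℝ) :=
    Real.summable_pow_div_factorial _
  have h2 : Summable fun k : ℕ => ((1 : ℝ) / 4) ^ k :=
    summable_geometric_of_lt_one (by norm_num) (by norm_num)
  refine Summable.of_norm_bounded (h1.add h2) fun k => ?_
  have hf : (0 : ℝ) < k.factorial := by exact_mod_cast k.factorial_pos
  set s := Real.sqrt k.factorial with hs
  have hs0 : 0 < s := Real.sqrt_pos.mpr hf
  have hss : s ^ 2 = k.factorial := Real.sq_sqrt hf.le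
  set u := (2 * |x|) ^ k / s with hu
  set v := ((1 : ℝ) / 2) ^ k with hv
  have e1 : ‖x ^ k / s‖ = u * v := by
    rw [norm_div, norm_pow, Real.norm_eq_abs, Real.norm_eq_abs, abs_of_pos hs0, hu, hv,
      div_mul_eq_mul_div, ← mul_pow]
    congr 2; ring
  have e2 : (4 * x ^ 2) ^ k / (k.factorial : ℝ) = u ^ 2 := by
    have : (2 * |x|) ^ 2 = 4 * x ^ 2 := by rw [mul_pow, sq_abs]; norm_num
    rw [hu, div_pow, hss, ← pow_mul, mul_comm k 2, pow_mul, this]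
  have e3 : ((1 : ℝ) / 4) ^ k = v ^ 2 := by
    rw [hv, ← pow_mul, mul_comm k 2, pow_mul]; norm_num
  rw [e1, e2, e3]
  nlinarith [sq_nonneg (u - v), sq_nonneg (u + v)]

lemma isExpGenerator_displacementGen {M : ℕ} (α : Fin M → ℂ) :
    IsExpGenerator (displacementGen α) where
  skew := displacementGen_skew α
  summable := by
    intro n
    set N := ∑ i, n i with hN
    set C := ∑ m, 2 * ‖α m‖ with hC
    have hC0 : 0 ≤ C := by positivity
    refine Summable.of_nonneg_of_le (fun _ => norm_nonneg _) (fun k => ?_)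
      ((summable_pow_div_sqrt_factorial (Real.sqrt 2 * C)).mul_left (Real.sqrt 2 ^ N))
    have h := displacementGen_bound α k N n le_rfl
    have hf : (0 : ℝ) < k.factorial := by exact_mod_cast k.factorial_pos
    have hasc : ((N + 1).ascFactorial k : ℝ) ≤ 2 ^ (N + k) * k.factorial := by
      have h1 := Nat.ascFactorial_eq_factorial_mul_choose N k
      have h2 : (N + k).choose k ≤ 2 ^ (N + k) := Nat.choose_le_two_pow _ _
      have h3 : (N + 1).ascFactorial k ≤ 2 ^ (N + k) * k.factorial := by
        rw [h1, mul_comm]; exact Nat.mul_le_mul_right _ h2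
      exact_mod_cast h3
    have hsq : Real.sqrt ((N + 1).ascFactorial k) ≤
        Real.sqrt 2 ^ (N + k) * Real.sqrt k.factorial := by
      refine (Real.sqrt_le_sqrt hasc).trans (le_of_eq ?_)
      rw [Real.sqrt_mul (by positivity)]
      congr 1
      rw [Real.sqrt_eq_iff_mul_self_eq (by positivity) (by positivity), ← mul_pow]
      norm_num
    have hs0 : 0 < Real.sqrt k.factorial := Real.sqrt_pos.mpr hf
    have hss : Real.sqrt k.factorial * Real.sqrt k.factorial = k.factorial :=
      Real.mul_self_sqrt hf.le
    rw [norm_smul, norm_inv, Complex.norm_natCast]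
    calc _ ≤ (k.factorial : ℝ)⁻¹ * (C ^ k * (Real.sqrt 2 ^ (N + k) * Real.sqrt k.factorial)) := by
          gcongr
          exact h.trans (by gcongr)
      _ = _ := by
          have hi : (k.factorial : ℝ)⁻¹ * Real.sqrt k.factorial = (Real.sqrt k.factorial)⁻¹ := by
            apply eq_inv_of_mul_eq_one_left
            rw [mul_assoc, hss, inv_mul_cancel₀ hf.ne']
          rw [div_eq_mul_inv, ← hi, pow_add, mul_pow]
          ring

lemma isExpGenerator_bilinearGen {M : ℕ} (L : Matrix (Fin M) (Fin M) ℂ)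
    (hL : L.conjTranspose = -L) : IsExpGenerator (bilinearGen L) where
  skew := bilinearGen_skew L hL
  summable := by
    intro n
    refine Summable.of_nonneg_of_le (fun _ => norm_nonneg _) (fun k => ?_)
      (Real.summable_pow_div_factorial ((∑ i, ∑ j, ‖L i j‖) * ((∑ i, n i : ℕ) + 1)))
    rw [norm_smul, norm_inv, Complex.norm_natCast, inv_mul_eq_div]
    gcongr
    exact bilinearGen_bound L _ k n le_rfl

/-- The displacement operator `D(α) = exp(∑_m (α_m a_m† - α_m^* a_m))`. -/
def displacement {M : ℕ} (α : Fin M → ℂ) : Fock M →L[ℂ] Fock M :=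
  expOp (displacementGen α) (isExpGenerator_displacementGen α)

/-- The operator `exp(∑_{i,j} L_{ij} a_i† a_j)` for a skew-Hermitian matrix `L`. -/
def bilinearExp {M : ℕ} (L : Matrix (Fin M) (Fin M) ℂ) (hL : L.conjTranspose = -L) :
    Fock M →L[ℂ] Fock M :=
  expOp (bilinearGen L) (isExpGenerator_bilinearGen L hL)

/-- `U` is the multiport beamsplitter `exp(a† (log 𝒰) a)` of the unitary matrix `𝒰`, where
`log 𝒰` is a skew-Hermitian logarithm of `𝒰`. -/
def IsMultiportBeamsplitter {M : ℕ} (𝒰 : Matrix.unitaryGroup (Fin M) ℂ)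
    (U : Fock M →L[ℂ] Fock M) : Prop :=
  ∃ (L : Matrix (Fin M) (Fin M) ℂ) (hL : L.conjTranspose = -L),
    NormedSpace.exp L = (𝒰 : Matrix (Fin M) (Fin M) ℂ) ∧ U = bilinearExp L hL

/-- The matrix `-iπ·1`. -/
def parityMatrix (M : ℕ) : Matrix (Fin M) (Fin M) ℂ := (-(Complex.I * Real.pi)) • 1

lemma parityMatrix_skew (M : ℕ) : (parityMatrix M).conjTranspose = -parityMatrix M := by
  simp [parityMatrix, Matrix.conjTranspose_smul]

/-- The total parity operator `Π = exp(-iπ ∑_m a_m† a_m)`. -/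
def parity (M : ℕ) : Fock M →L[ℂ] Fock M := bilinearExp (parityMatrix M) (parityMatrix_skew M)

/-! ### States, Wigner function and absolute Wigner volume -/

/-- The trace `∑_n ⟨n|T|n⟩` of a (trace-class) operator. -/
def trace {M : ℕ} (T : Fock M →L[ℂ] Fock M) : ℂ := ∑' n, inner ℂ (ket n) (T (ket n))

/-- Density operators: positive operators with (convergent) trace `1`. -/
def IsState {M : ℕ} (ρ : Fock M →L[ℂ] Fock M) : Prop :=
  ρ.IsPositive ∧ HasSum (fun n => inner ℂ (ket n) (ρ (ket n))) 1

/-- The displaced parity operator `Π(α) = D(α) Π D(α)†`. -/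
def displacedParity {M : ℕ} (α : Fin M → ℂ) : Fock M →L[ℂ] Fock M :=
  displacement α ∘L parity M ∘L ContinuousLinearMap.adjoint (displacement α)

/-- The Wigner function `W_ρ(α) = (2/π)^M tr[ρ Π(α)]`. -/
def wigner {M : ℕ} (ρ : Fock M →L[ℂ] Fock M) (α : Fin M → ℂ) : ℂ :=
  ((2 / Real.pi : ℝ) : ℂ) ^ M * trace (ρ ∘L displacedParity α)

/-- The absolute Wigner volume
`𝒱(ρ; ω) = (π/2)^(M-1) ∫_ω |W_ρ(α y + α^* z)| d²α ∈ [0, ∞]`. -/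
def absVolume {M : ℕ} (y z : Fin M → ℂ) (ρ : Fock M →L[ℂ] Fock M) (ω : Set ℂ) : ℝ≥0∞ :=
  ENNReal.ofReal ((Real.pi / 2) ^ (M - 1)) *
    ∫⁻ α in ω, ‖wigner ρ (fun m => α * y m + conj α * z m)‖ₑ

/-- The absolute Wigner volume along the slice `{α (1, …, 1) : α ∈ ℂ}`. -/
def diagVolume {M : ℕ} (ρ : Fock M →L[ℂ] Fock M) : ℝ≥0∞ :=
  absVolume (fun _ => 1) (fun _ => 0) ρ Set.univ

/-! ### Interference with vacua -/

lemma vacuum_kets_orthonormal (M : ℕ) [NeZero M] :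
    Orthonormal ℂ fun n : Fin 1 → ℕ => ket (Pi.single (0 : Fin M) (n 0)) := by
  refine ket_orthonormal.comp _ fun n n' h => ?_
  funext i
  rw [Subsingleton.elim i 0]
  exact Pi.single_injective (0 : Fin M) h

/-- The isometry `ψ ↦ ψ ⊗ |0⟩^{⊗(M-1)}`, where `ψ` sits in the first mode. -/
def tensorVacuum (M : ℕ) [NeZero M] : Fock 1 →L[ℂ] Fock M :=
  (vacuum_kets_orthonormal M).orthogonalFamily.linearIsometry.toContinuousLinearMap

/-- `ρ₁ ⊗ (|0⟩⟨0|)^{⊗(M-1)} = J ρ₁ J†` with `J ψ = ψ ⊗ |0⟩^{⊗(M-1)}`. -/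
def withVacua (M : ℕ) [NeZero M] (ρ₁ : Fock 1 →L[ℂ] Fock 1) : Fock M →L[ℂ] Fock M :=
  tensorVacuum M ∘L ρ₁ ∘L ContinuousLinearMap.adjoint (tensorVacuum M)

/-- `U (ρ₁ ⊗ (|0⟩⟨0|)^{⊗(M-1)}) U†`. -/
def interfere {M : ℕ} [NeZero M] (U : Fock M →L[ℂ] Fock M) (ρ₁ : Fock 1 →L[ℂ] Fock 1) :
    Fock M →L[ℂ] Fock M :=
  U ∘L withVacua M ρ₁ ∘L ContinuousLinearMap.adjoint U

/-- The rank-one operator `|ψ⟩⟨ψ|`. -/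
def pureState {M : ℕ} (ψ : Fock M) : Fock M →L[ℂ] Fock M := InnerProductSpace.rankOne ℂ ψ ψ

/-- The `W` state `(|10…0⟩ + |01…0⟩ + ⋯ + |00…1⟩)/√M`. -/
def wState (M : ℕ) : Fock M :=
  (((Real.sqrt M : ℝ) : ℂ)⁻¹) • ∑ m : Fin M, ket (Pi.single m 1)

/-- `U` is balanced with respect to the first mode: for every `m`, on finite combinations of
number states, `√M U† a_m U = a_1 + ∑_{m' ≠ 1} c_{m,m'} a_{m'}`. -/
def IsBalanced {M : ℕ} [NeZero M] (U : Fock M →L[ℂ] Fock M) (c : Fin M → Fin M → ℂ) : Prop :=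
  ∀ (m : Fin M) (f : FinVec M), ∃ h : U (toFock f) ∈ (annihilation m).domain,
    ((Real.sqrt M : ℝ) : ℂ) • ContinuousLinearMap.adjoint U (annihilation m ⟨U (toFock f), h⟩) =
      toFock (annFin 0 f) + ∑ m' ∈ Finset.univ.erase 0, c m m' • toFock (annFin m' f)

end BosonicModes

end

open BosonicModes

/-!
Displacements, beamsplitters and the parity are explicit on the exponential vectors
`e_γ = ∑ₙ γⁿ/√n! |n⟩`, and these vectors are total: a beamsplitter maps `e_γ` to `e_{𝒰γ}` and a
displaced parity at `α` maps it to a multiple of `e_{2α - γ}`. The balance condition evaluated on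
one photon says that the first column of `𝒰` is constant equal to `1/√M`, so adding vacua and
interfering is the isometry `e_z ↦ e_{z(1, …, 1)/√M}`, which pulls the displaced parity at
`α(1, …, 1)` back to the one-mode displaced parity at `√M α`. Rescaling the integral over `ℂ` gives
the factor `1/M`.

Photon-number components are Taylor coefficients of `s ↦ e_{sγ}`. The coefficient of `s` gives both
the image `|W_M⟩` of the one-photon state and its Wigner function, which up to normalization and the
scaling by `√M` is the radial function `(2/π)(4|α|² - 1) exp(-2|α|²)`, changing sign at `|α| = 1/2`.
-/

namespace BosonicModes

open scoped Matrix

section Trace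

variable {𝕜 H K ι κ : Type*} [RCLike 𝕜]
  [NormedAddCommGroup H] [InnerProductSpace 𝕜 H]
  [NormedAddCommGroup K] [InnerProductSpace 𝕜 K]

lemma summable_sq_norm_comp {L : Type*} [NormedAddCommGroup L] [InnerProductSpace 𝕜 L]
    {S : H →L[𝕜] K} {b : ι → H} (hS : Summable fun i => ‖S (b i)‖ ^ 2) (T : K →L[𝕜] L) :
    Summable fun i => ‖(T ∘L S) (b i)‖ ^ 2 := by
  refine .of_nonneg_of_le (fun _ => by positivity) (fun i => ?_) (hS.mul_left (‖T‖ ^ 2))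
  rw [← mul_pow]
  gcongr
  exact T.le_opNorm _

lemma summable_sq_norm_matrixCoeff {P : H →L[𝕜] K} {b : ι → H} {c : κ → K}
    (hc : Orthonormal 𝕜 c) (hP : Summable fun i => ‖P (b i)‖ ^ 2) :
    Summable fun p : ι × κ => ‖inner 𝕜 (c p.2) (P (b p.1))‖ ^ 2 := by
  rw [summable_prod_of_nonneg fun _ => by positivity]
  refine ⟨fun i => hc.inner_products_summable (P (b i)), .of_nonneg_of_le
    (fun _ => tsum_nonneg fun _ => by positivity) (fun i => ?_) hP⟩
  exact hc.tsum_inner_products_le (P (b i))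

/- Both sides sum the family `⟪Q bᵢ, cⱼ⟫ ⟪cⱼ, P bᵢ⟫`, in the two possible orders. -/
lemma tsum_inner_adjoint_adjoint [CompleteSpace H] [CompleteSpace K]
    (b : HilbertBasis ι 𝕜 H) (c : HilbertBasis κ 𝕜 K) {P Q : H →L[𝕜] K}
    (hP : Summable fun i => ‖P (b i)‖ ^ 2) (hQ : Summable fun i => ‖Q (b i)‖ ^ 2) :
    ∑' j, inner 𝕜 (P.adjoint (c j)) (Q.adjoint (c j)) = ∑' i, inner 𝕜 (Q (b i)) (P (b i)) := by
  have hsum : Summable fun p : ι × κ =>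
      inner 𝕜 (Q (b p.1)) (c p.2) * inner 𝕜 (c p.2) (P (b p.1)) := by
    refine .of_norm_bounded ((summable_sq_norm_matrixCoeff c.orthonormal hQ).add
      (summable_sq_norm_matrixCoeff c.orthonormal hP)) fun p => ?_
    rw [norm_mul, norm_inner_symm]
    nlinarith [two_mul_le_add_sq ‖inner 𝕜 (c p.2) (Q (b p.1))‖ ‖inner 𝕜 (c p.2) (P (b p.1))‖,
      norm_nonneg (inner 𝕜 (c p.2) (Q (b p.1))), norm_nonneg (inner 𝕜 (c p.2) (P (b p.1)))]
  calc ∑' j, inner 𝕜 (P.adjoint (c j)) (Q.adjoint (c j))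
      = ∑' j, ∑' i, inner 𝕜 (Q (b i)) (c j) * inner 𝕜 (c j) (P (b i)) := by
        refine tsum_congr fun j => ?_
        rw [← b.tsum_inner_mul_inner]
        refine tsum_congr fun i => ?_
        rw [P.adjoint_inner_left, Q.adjoint_inner_right, mul_comm]
    _ = ∑' i, ∑' j, inner 𝕜 (Q (b i)) (c j) * inner 𝕜 (c j) (P (b i)) :=
        Summable.tsum_comm hsum
    _ = ∑' i, inner 𝕜 (Q (b i)) (P (b i)) := by simp only [c.tsum_inner_mul_inner]

end Trace

section PositiveTrace

variable {H K ι κ : Type*} [NormedAddCommGroup H] [InnerProductSpace ℂ H] [CompleteSpace H]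
  [NormedAddCommGroup K] [InnerProductSpace ℂ K] [CompleteSpace K]

lemma exists_sqrt_of_isPositive {ρ : H →L[ℂ] H} (hρ : ρ.IsPositive) :
    ∃ S : H →L[ℂ] H, S.adjoint = S ∧ S ∘L S = ρ := by
  have hρ' : 0 ≤ ρ := ρ.nonneg_iff_isPositive.mpr hρ
  exact ⟨CFC.sqrt ρ,
    ((CFC.sqrt ρ).nonneg_iff_isPositive.mp (CFC.sqrt_nonneg ρ)).isSelfAdjoint,
    CFC.sqrt_mul_sqrt_self ρ hρ'⟩

lemma tsum_inner_conj_comp (b : HilbertBasis ι ℂ H) (c : HilbertBasis κ ℂ K) {ρ : H →L[ℂ] H}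
    (hρ : ρ.IsPositive) (htr : Summable fun i => inner ℂ (b i) (ρ (b i)))
    (V : H →L[ℂ] K) (T : K →L[ℂ] K) :
    ∑' j, inner ℂ (c j) (((V ∘L ρ ∘L V.adjoint) ∘L T) (c j)) =
      ∑' i, inner ℂ (b i) ((ρ ∘L V.adjoint ∘L T ∘L V) (b i)) := by
  obtain ⟨S, hS, rfl⟩ := exists_sqrt_of_isPositive hρ
  have inner_S_left (x y : H) : inner ℂ (S x) y = inner ℂ x (S y) := by
    rw [← S.adjoint_inner_right, hS]
  have hilbertSchmidt : Summable fun i => ‖S (b i)‖ ^ 2 := by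
    refine htr.norm.congr fun i => ?_
    rw [S.comp_apply, ← inner_S_left, inner_self_eq_norm_sq_to_K]
    simp
  have conj_trace := tsum_inner_adjoint_adjoint b c (summable_sq_norm_comp hilbertSchmidt V)
    (summable_sq_norm_comp hilbertSchmidt (T.adjoint ∘L V))
  have pullback_trace := tsum_inner_adjoint_adjoint b b hilbertSchmidt
    (summable_sq_norm_comp hilbertSchmidt (V.adjoint ∘L T.adjoint ∘L V))
  simp only [ContinuousLinearMap.adjoint_comp, ContinuousLinearMap.adjoint_adjoint, hS,
    ContinuousLinearMap.comp_apply, inner_S_left, ContinuousLinearMap.adjoint_inner_left]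
    at conj_trace pullback_trace ⊢
  rw [conj_trace, pullback_trace]

end PositiveTrace

section NumberStates

variable {M N : ℕ}

/-- The number states, as a Hilbert basis of the Fock space. -/
noncomputable def ketBasis (M : ℕ) : HilbertBasis (Fin M → ℕ) ℂ (Fock M) :=
  HilbertBasis.ofRepr (LinearIsometryEquiv.refl ℂ _)

lemma ketBasis_apply (n : Fin M → ℕ) : ketBasis M n = ket n := by
  classical
  rw [← HilbertBasis.repr_symm_single]
  rfl

lemma inner_ket_left (n : Fin M → ℕ) (ψ : Fock M) : inner ℂ (ket n) ψ = ψ n := by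
  rw [← ketBasis_apply, ← HilbertBasis.repr_apply_apply]
  rfl

lemma hasSum_ket (ψ : Fock M) : HasSum (fun n => ψ n • ket n) ψ := by
  refine ((ketBasis M).hasSum_repr ψ).congr_fun fun n => ?_
  rw [ketBasis_apply, HilbertBasis.repr_apply_apply, ketBasis_apply, inner_ket_left]

lemma ext_ket {E : Type*} [NormedAddCommGroup E] [NormedSpace ℂ E] {A B : Fock M →L[ℂ] E}
    (h : ∀ n, A (ket n) = B (ket n)) : A = B := by
  ext1 ψ
  have hA := A.hasSum (hasSum_ket ψ)
  simp only [map_smul, h] at hA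
  exact hA.unique (by simpa only [map_smul] using B.hasSum (hasSum_ket ψ))

lemma trace_conj_comp {ρ : Fock N →L[ℂ] Fock N} (hρ : IsState ρ) (V : Fock N →L[ℂ] Fock M)
    (T : Fock M →L[ℂ] Fock M) :
    trace ((V ∘L ρ ∘L V.adjoint) ∘L T) = trace (ρ ∘L V.adjoint ∘L T ∘L V) := by
  have hdiag : Summable fun n => inner ℂ (ketBasis N n) (ρ (ketBasis N n)) := by
    simpa only [ketBasis_apply] using hρ.2.summable
  simpa only [trace, ketBasis_apply] using
    tsum_inner_conj_comp (ketBasis N) (ketBasis M) hρ.1 hdiag V T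

lemma trace_pureState_comp (ψ : Fock M) (T : Fock M →L[ℂ] Fock M) :
    trace (pureState ψ ∘L T) = inner ℂ ψ (T ψ) := by
  rw [← T.adjoint_inner_left, ← (ketBasis M).tsum_inner_mul_inner]
  refine tsum_congr fun n => ?_
  rw [ketBasis_apply, ContinuousLinearMap.comp_apply, pureState, InnerProductSpace.rankOne_apply,
    inner_smul_right, T.adjoint_inner_left]

lemma conj_pureState (V : Fock N →L[ℂ] Fock M) (ψ : Fock N) :
    V ∘L pureState ψ ∘L V.adjoint = pureState (V ψ) := by
  ext1 φ
  simp [pureState, V.adjoint_inner_right]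

end NumberStates

section Exponentials

variable {M : ℕ} {X : FinVec M →ₗ[ℂ] FinVec M}

lemma neg_pow_apply {R V : Type*} [CommRing R] [AddCommGroup V] [Module R V]
    (X : V →ₗ[R] V) (k : ℕ) (v : V) : ((-X) ^ k) v = (-1 : R) ^ k • (X ^ k) v := by
  rw [← neg_one_smul R X, smul_pow, LinearMap.smul_apply]

lemma IsExpGenerator.neg (hX : IsExpGenerator X) : IsExpGenerator (-X) where
  skew f g := by simp [hX.skew]
  summable n := by simpa [neg_pow_apply, norm_smul] using hX.summable n

lemma hasSum_expKet (hX : IsExpGenerator X) (n : Fin M → ℕ) :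
    HasSum (fun k : ℕ => (k.factorial : ℂ)⁻¹ • toFock ((X ^ k) (Finsupp.single n 1)))
      (expKet X n) :=
  (hX.summable n).of_norm.hasSum

lemma hasSum_inner_expKet_left (hX : IsExpGenerator X) (n : Fin M → ℕ) (ψ : Fock M) :
    HasSum (fun k : ℕ => (k.factorial : ℂ)⁻¹ * inner ℂ (toFock ((X ^ k) (Finsupp.single n 1))) ψ)
      (inner ℂ (expKet X n) ψ) := by
  simpa [inner_smul_left] using (innerSLFlip ℂ ψ).hasSum (hasSum_expKet hX n)

lemma adjoint_expOp (hX : IsExpGenerator X) : (expOp X hX).adjoint = expOp (-X) hX.neg := by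
  refine ext_ket fun n => lp.ext <| funext fun k => ?_
  rw [← inner_ket_left, ← inner_ket_left, ContinuousLinearMap.adjoint_inner_right, expOp_ket,
    expOp_ket]
  have hright := (innerSL ℂ (ket k)).hasSum (hasSum_expKet hX.neg n)
  refine (hasSum_inner_expKet_left hX k (ket n)).unique (hright.congr_fun fun j => ?_)
  have hskew := skew_pow hX.skew j (Finsupp.single k 1) (Finsupp.single n 1)
  simp only [toFock_single, one_smul] at hskew
  rw [hskew, innerSL_apply_apply, inner_smul_right, neg_pow_apply, map_smul, inner_smul_right]

lemma adjoint_expOp_comp_self (hX : IsExpGenerator X) :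
    (expOp X hX).adjoint ∘L expOp X hX = 1 :=
  (ContinuousLinearMap.norm_map_iff_adjoint_comp_self _).mp
    (expKet_orthonormal hX).orthogonalFamily.linearIsometry.norm_map

/- The Taylor coefficients of the entire function `s ↦ ⟨n|Ψ s⟩` at `0` are `⟨(-X)ᵏ n|Ψ 0⟩ / k!`, the
terms of the series `⟨e⁻ˣ n|Ψ 0⟩`. -/
lemma expOp_apply_flow (hX : IsExpGenerator X) {Ψ : ℂ → Fock M}
    (hΨ : ∀ n s, HasDerivAt (fun s => Ψ s n)
      (-inner ℂ (toFock (X (Finsupp.single n 1))) (Ψ s)) s) :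
    expOp X hX (Ψ 0) = Ψ 1 := by
  have hderiv (f : FinVec M) (s : ℂ) : HasDerivAt (fun s => inner ℂ (toFock f) (Ψ s))
      (inner ℂ (toFock ((-X) f)) (Ψ s)) s := by
    induction f using Finsupp.induction_linear with
    | zero => simpa using hasDerivAt_const s (0 : ℂ)
    | add f g hf hg =>
      simp only [map_add, inner_add_left]
      exact hf.add hg
    | single n c =>
      have h := (hΨ n s).const_mul (conj c)
      rw [← Finsupp.smul_single_one]
      simpa only [map_smul, LinearMap.neg_apply, map_neg, toFock_single, one_smul, inner_smul_left,
        inner_neg_left, inner_ket_left] using h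
  have hiter (k : ℕ) (f : FinVec M) : iteratedDeriv k (fun s => inner ℂ (toFock f) (Ψ s)) =
      fun s => inner ℂ (toFock (((-X) ^ k) f)) (Ψ s) := by
    induction k with
    | zero => simp
    | succ k ih =>
      funext s
      rw [iteratedDeriv_succ, ih, (hderiv _ s).deriv, pow_succ', Module.End.mul_apply]
  refine lp.ext <| funext fun n => ?_
  rw [← inner_ket_left, ← ContinuousLinearMap.adjoint_inner_left, adjoint_expOp, expOp_ket]
  have hentire : Differentiable ℂ (fun s => Ψ s n) := fun s => (hΨ n s).differentiableAt
  refine (hasSum_inner_expKet_left hX.neg n (Ψ 0)).unique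
    ((Complex.hasSum_taylorSeries_of_entire hentire 0 1).congr_fun fun k => ?_)
  have hcoeff := congrFun (hiter k (Finsupp.single n 1)) 0
  simp only [toFock_single, one_smul, inner_ket_left] at hcoeff
  simp [hcoeff]

end Exponentials

section ExponentialVectors

variable {M : ℕ}

/-- The number-state amplitude `zᵏ / √k!` of a one-mode exponential vector. -/
noncomputable def expCoeff (z : ℂ) (k : ℕ) : ℂ := z ^ k / (√k.factorial : ℝ)

lemma sqrt_factorial_succ (k : ℕ) :
    ((√(k + 1).factorial : ℝ) : ℂ) = (√(k + 1) : ℝ) * (√k.factorial : ℝ) := by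
  rw [← Complex.ofReal_mul, ← Real.sqrt_mul (by positivity), Nat.factorial_succ]
  push_cast
  rfl

lemma sqrt_mul_expCoeff_succ (z : ℂ) (k : ℕ) :
    (√(k + 1) : ℝ) * expCoeff z (k + 1) = z * expCoeff z k := by
  have hk : ((√(k + 1) : ℝ) : ℂ) ≠ 0 := Complex.ofReal_ne_zero.mpr (by positivity)
  rw [expCoeff, expCoeff, sqrt_factorial_succ, ← mul_div_assoc, mul_div_mul_left _ _ hk,
    pow_succ', mul_div_assoc]

lemma hasDerivAt_expCoeff (z : ℂ) (k : ℕ) :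
    HasDerivAt (fun z => expCoeff z k) ((√k : ℝ) * expCoeff z (k - 1)) z := by
  refine ((hasDerivAt_pow k z).div_const _).congr_deriv ?_
  rcases k with _ | k
  · simp
  · have hk : ((√(k + 1) : ℝ) : ℂ) ≠ 0 := Complex.ofReal_ne_zero.mpr (by positivity)
    have hsq : (√(k + 1) : ℝ) * ((√(k + 1) : ℝ) : ℂ) = k + 1 := by
      rw [← Complex.ofReal_mul, Real.mul_self_sqrt (by positivity)]
      simp
    rw [expCoeff, Nat.add_sub_cancel, sqrt_factorial_succ, Nat.cast_add_one, Nat.cast_add_one,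
      ← hsq, mul_assoc, mul_div_mul_left _ _ hk, mul_div_assoc]

lemma summable_prod_apply {ι : Type*} [Fintype ι] {κ : ι → Type*} {g : ∀ i, κ i → ℝ}
    (hg₀ : ∀ i k, 0 ≤ g i k) (hg : ∀ i, Summable (g i)) :
    Summable fun n : ∀ i, κ i => ∏ i, g i (n i) := by
  classical
  refine summable_of_sum_le (c := ∏ i, ∑' k, g i k)
    (fun n => Finset.prod_nonneg fun i _ => hg₀ _ _) fun s => ?_
  calc ∑ n ∈ s, ∏ i, g i (n i)
      ≤ ∑ n ∈ Fintype.piFinset fun i => s.image fun n => n i, ∏ i, g i (n i) :=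
        Finset.sum_le_sum_of_subset_of_nonneg
          (fun n hn => Fintype.mem_piFinset.mpr fun i => Finset.mem_image_of_mem (· i) hn)
          fun n _ _ => Finset.prod_nonneg fun i _ => hg₀ _ _
    _ = ∏ i, ∑ k ∈ s.image fun n => n i, g i k := (Finset.prod_univ_sum _ _).symm
    _ ≤ ∏ i, ∑' k, g i k := Finset.prod_le_prod
        (fun i _ => Finset.sum_nonneg fun k _ => hg₀ _ _)
        fun i _ => (hg i).sum_le_tsum _ fun k _ => hg₀ _ _

lemma summable_sq_norm_expCoeff (z : ℂ) : Summable fun k => ‖expCoeff z k‖ ^ 2 := by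
  refine (Real.summable_pow_div_factorial (‖z‖ ^ 2)).congr fun k => ?_
  rw [expCoeff, norm_div, div_pow, norm_pow, Complex.norm_real, Real.norm_eq_abs, sq_abs,
    Real.sq_sqrt (by positivity), pow_right_comm]

lemma memℓp_prod_expCoeff (β : Fin M → ℂ) :
    Memℓp (fun n : Fin M → ℕ => ∏ m, expCoeff (β m) (n m)) 2 := by
  refine memℓp_gen ((summable_prod_apply (g := fun m k => ‖expCoeff (β m) k‖ ^ 2)
    (fun _ _ => by positivity) fun m => summable_sq_norm_expCoeff (β m)).congr fun n => ?_)
  simp [Finset.prod_pow]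

/-- The exponential vector `∑ₙ ∏ₘ (βₘ ^ nₘ / √nₘ!) |n⟩`, an unnormalized coherent state. -/
noncomputable def expVec (β : Fin M → ℂ) : Fock M := ⟨_, memℓp_prod_expCoeff β⟩

lemma expVec_apply (β : Fin M → ℂ) (n : Fin M → ℕ) :
    expVec β n = ∏ m, expCoeff (β m) (n m) := rfl

lemma expVec_apply_of_eq_off (β : Fin M → ℂ) {m : Fin M} {n n' : Fin M → ℕ}
    (h : ∀ i ≠ m, n' i = n i) :
    expVec β n' =
      expCoeff (β m) (n' m) * ∏ i ∈ Finset.univ.erase m, expCoeff (β i) (n i) := by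
  rw [expVec_apply, ← Finset.mul_prod_erase _ _ (Finset.mem_univ m)]
  congr 1
  exact Finset.prod_congr rfl fun i hi => by rw [h i (Finset.ne_of_mem_erase hi)]

lemma sqrt_mul_expVec_add_single (β : Fin M → ℂ) (n : Fin M → ℕ) (m : Fin M) :
    (√(n m + 1) : ℝ) * expVec β (n + Pi.single m 1) = β m * expVec β n := by
  rw [expVec_apply_of_eq_off β (m := m) (n := n) fun i hi => by simp [hi],
    expVec_apply_of_eq_off β (m := m) (n := n) fun _ _ => rfl, ← mul_assoc, ← mul_assoc,
    Pi.add_apply, Pi.single_eq_same, sqrt_mul_expCoeff_succ]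

lemma hasDerivAt_expVec_apply {γ : ℂ → Fin M → ℂ} {γ' : Fin M → ℂ} {s : ℂ}
    (hγ : HasDerivAt γ γ' s) (n : Fin M → ℕ) :
    HasDerivAt (fun s => expVec (γ s) n)
      (∑ m, γ' m * ((√(n m) : ℝ) * expVec (γ s) (n - Pi.single m 1))) s := by
  have h := HasDerivAt.fun_finsetProd (u := Finset.univ) fun m _ =>
    (hasDerivAt_expCoeff (γ s m) (n m)).comp s (hasDerivAt_pi.mp hγ m)
  refine h.congr_deriv (Finset.sum_congr rfl fun m _ => ?_)
  rw [expVec_apply_of_eq_off _ (m := m) (n := n) fun i hi => by simp [hi]]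
  simp only [Pi.sub_apply, Pi.single_eq_same, smul_eq_mul, Function.comp_apply]
  ring

end ExponentialVectors

section GaussianUnitaries

variable {M : ℕ}

lemma inner_creFin_expVec (m : Fin M) (γ : Fin M → ℂ) (f : FinVec M) :
    inner ℂ (toFock (creFin m f)) (expVec γ) = γ m * inner ℂ (toFock f) (expVec γ) := by
  induction f using Finsupp.induction_linear with
  | zero => simp
  | add f g hf hg => simp only [map_add, inner_add_left, hf, hg, mul_add]
  | single n c =>
    rw [← Finsupp.smul_single_one, map_smul, creFin_single]
    simp only [map_smul, toFock_single, one_smul, inner_smul_left, inner_ket_left,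
      Complex.conj_ofReal, sqrt_mul_expVec_add_single, mul_left_comm (γ m)]

lemma inner_annFin_expVec (m : Fin M) (γ : Fin M → ℂ) (n : Fin M → ℕ) :
    inner ℂ (toFock (annFin m (Finsupp.single n 1))) (expVec γ) =
      (√(n m) : ℝ) * expVec γ (n - Pi.single m 1) := by
  simp [inner_ket_left]

lemma inner_displacementGen_expVec (α γ : Fin M → ℂ) (n : Fin M → ℕ) :
    inner ℂ (toFock (displacementGen α (Finsupp.single n 1))) (expVec γ) =
      (star α ⬝ᵥ γ) * expVec γ n -
        ∑ m, α m * ((√(n m) : ℝ) * expVec γ (n - Pi.single m 1)) := by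
  simp only [displacementGen, LinearMap.sum_apply, LinearMap.sub_apply, LinearMap.smul_apply,
    map_sum, map_sub, map_smul, sum_inner, inner_sub_left, inner_smul_left, inner_creFin_expVec,
    inner_annFin_expVec, Finset.sum_sub_distrib, toFock_single, one_smul,
    inner_ket_left, dotProduct, Finset.sum_mul, mul_assoc, Pi.star_apply, starRingEnd_apply,
    star_star]

lemma inner_bilinearGen_expVec {L : Matrix (Fin M) (Fin M) ℂ} (hL : Lᴴ = -L) (γ : Fin M → ℂ)
    (n : Fin M → ℕ) :
    inner ℂ (toFock (bilinearGen L (Finsupp.single n 1))) (expVec γ) =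
      -∑ j, (L *ᵥ γ) j * ((√(n j) : ℝ) * expVec γ (n - Pi.single j 1)) := by
  have hconj (i j : Fin M) : conj (L i j) = -L j i := congrFun (congrFun hL j) i
  simp only [bilinearGen, LinearMap.sum_apply, LinearMap.smul_apply, LinearMap.comp_apply, map_sum,
    map_smul, sum_inner, inner_smul_left, inner_creFin_expVec, inner_annFin_expVec, hconj,
    Matrix.mulVec, dotProduct, Finset.sum_mul, neg_mul, Finset.sum_neg_distrib, mul_assoc]
  rw [Finset.sum_comm]

/- Along the ray `β + s α` the generator acts on exponential vectors by differentiation, up to the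
scalar `⟨α, β + s α⟩`, which the Gaussian prefactor integrates. -/
lemma displacement_expVec (α β : Fin M → ℂ) :
    displacement α (expVec β) =
      Complex.exp (-(star α ⬝ᵥ α) / 2 - star α ⬝ᵥ β) • expVec (β + α) := by
  have h := expOp_apply_flow (isExpGenerator_displacementGen α)
    (Ψ := fun s => Complex.exp (-(star α ⬝ᵥ α) / 2 * s ^ 2 - (star α ⬝ᵥ β) * s) •
      expVec (β + s • α)) fun n s => ?_
  · simpa [displacement] using h
  have hexp := (((hasDerivAt_pow 2 s).const_mul (-(star α ⬝ᵥ α) / 2)).sub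
    ((hasDerivAt_id s).const_mul (star α ⬝ᵥ β))).cexp
  have hray : HasDerivAt (fun s : ℂ => β + s • α) α s := by
    simpa using ((hasDerivAt_id s).smul_const α).const_add β
  refine (hexp.mul (hasDerivAt_expVec_apply hray n)).congr_deriv ?_
  rw [inner_smul_right, inner_displacementGen_expVec, dotProduct_add, dotProduct_smul]
  simp only [Pi.sub_apply, id_eq, smul_eq_mul]
  ring

section

attribute [local instance] Matrix.linftyOpNormedRing Matrix.linftyOpNormedAlgebra

lemma hasDerivAt_exp_smul_mulVec (L : Matrix (Fin M) (Fin M) ℂ) (β : Fin M → ℂ) (s : ℂ) :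
    HasDerivAt (fun s : ℂ => NormedSpace.exp (s • L) *ᵥ β)
      (L *ᵥ NormedSpace.exp (s • L) *ᵥ β) s := by
  have h := (LinearMap.toContinuousLinearMap
    ((Matrix.mulVecBilin ℂ ℂ).flip β)).hasFDerivAt.comp_hasDerivAt s
    (hasDerivAt_exp_smul_const' (𝕂 := ℂ) L s)
  rw [Matrix.mulVec_mulVec]
  exact h

end

lemma bilinearExp_expVec (L : Matrix (Fin M) (Fin M) ℂ) (hL : Lᴴ = -L) (β : Fin M → ℂ) :
    bilinearExp L hL (expVec β) = expVec (NormedSpace.exp L *ᵥ β) := by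
  have h := expOp_apply_flow (isExpGenerator_bilinearGen L hL)
    (Ψ := fun s => expVec (NormedSpace.exp (s • L) *ᵥ β)) fun n s =>
      (hasDerivAt_expVec_apply (hasDerivAt_exp_smul_mulVec L β s) n).congr_deriv <| by
        rw [inner_bilinearGen_expVec hL, neg_neg]
  simpa [bilinearExp] using h

lemma exp_parityMatrix (M : ℕ) : NormedSpace.exp (parityMatrix M) = -1 := by
  have hexp : NormedSpace.exp (-(Complex.I * Real.pi)) = -1 := by
    rw [← Complex.exp_eq_exp_ℂ, Complex.exp_neg, mul_comm, Complex.exp_pi_mul_I, inv_neg_one]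
  rw [parityMatrix, Matrix.smul_one_eq_diagonal, Matrix.exp_diagonal, ← Matrix.diagonal_one,
    Matrix.diagonal_neg]
  congr 1
  funext i
  rw [Pi.coe_exp, hexp]

lemma parity_expVec (β : Fin M → ℂ) : parity M (expVec β) = expVec (-β) := by
  rw [parity, bilinearExp_expVec, exp_parityMatrix, Matrix.neg_mulVec, Matrix.one_mulVec]

lemma adjoint_displacement (α : Fin M → ℂ) :
    (displacement α).adjoint = displacement (-α) := by
  have hneg : displacementGen (-α) = -displacementGen α := by
    refine LinearMap.ext fun f => eq_neg_of_add_eq_zero_left ?_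
    simp only [displacementGen, LinearMap.sum_apply, ← Finset.sum_add_distrib]
    exact Finset.sum_eq_zero fun m _ => by simp
  simp only [displacement, adjoint_expOp, hneg]

lemma displacedParity_expVec (α β : Fin M → ℂ) :
    displacedParity α (expVec β) =
      Complex.exp (-2 * (star α ⬝ᵥ α) + 2 * (star α ⬝ᵥ β)) • expVec (2 • α - β) := by
  simp only [displacedParity, ContinuousLinearMap.comp_apply, adjoint_displacement,
    displacement_expVec, parity_expVec, map_smul, smul_smul, ← Complex.exp_add]
  congr 2
  · simp only [star_neg, neg_dotProduct, dotProduct_neg, dotProduct_add]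
    ring
  · abel

end GaussianUnitaries

section PhotonNumber

lemma hasFPowerSeriesAt_zero_of_hasSum {𝕜 E : Type*} [NontriviallyNormedField 𝕜]
    [NormedAddCommGroup E] [NormedSpace 𝕜 E] {f : 𝕜 → E} {c : ℕ → E}
    (h : ∀ s, HasSum (fun k => s ^ k • c k) (f s)) :
    HasFPowerSeriesAt f (fun k => ContinuousMultilinearMap.mkPiRing 𝕜 (Fin k) (c k)) 0 :=
  hasFPowerSeriesAt_iff.mpr <| Filter.Eventually.of_forall fun s => by
    simpa [FormalMultilinearSeries.coeff] using h s

variable {M : ℕ}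

/-- The `k`-photon component of the exponential vector of `β`. -/
noncomputable def numberPart (k : ℕ) (β : Fin M → ℂ) : Fock M :=
  ∑ n ∈ Finset.univ.piAntidiag k, expVec β n • ket n

lemma expVec_smul_apply (s : ℂ) (β : Fin M → ℂ) (n : Fin M → ℕ) :
    expVec (s • β) n = s ^ (∑ m, n m) * expVec β n := by
  simp only [expVec_apply, expCoeff, Pi.smul_apply, smul_eq_mul, mul_pow, mul_div_assoc,
    Finset.prod_mul_distrib, Finset.prod_pow_eq_pow_sum]

lemma hasSum_numberPart (s : ℂ) (β : Fin M → ℂ) :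
    HasSum (fun k => s ^ k • numberPart k β) (expVec (s • β)) := by
  refine ((hasSum_ket (expVec (s • β))).tsum_fiberwise fun n => ∑ m, n m).congr_fun fun k => ?_
  have hfiber : (fun n : Fin M → ℕ => ∑ m, n m) ⁻¹' {k} =
      (Finset.univ.piAntidiag k : Finset (Fin M → ℕ)) := by
    ext n
    simp
  rw [hfiber, Finset.tsum_subtype' _ fun n => expVec (s • β) n • ket n, numberPart,
    Finset.smul_sum]
  refine Finset.sum_congr rfl fun n hn => ?_
  rw [expVec_smul_apply, (Finset.mem_piAntidiag.mp hn).1, mul_smul]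

lemma hasFPowerSeriesAt_expVec_smul (β : Fin M → ℂ) :
    HasFPowerSeriesAt (fun s : ℂ => expVec (s • β))
      (fun k => ContinuousMultilinearMap.mkPiRing ℂ (Fin k) (numberPart k β)) 0 :=
  hasFPowerSeriesAt_zero_of_hasSum fun s => hasSum_numberPart s β

lemma inner_numberPart_eq_zero {φ : Fock M} (h : ∀ β, inner ℂ φ (expVec β) = 0) (k : ℕ)
    (β : Fin M → ℂ) : inner ℂ φ (numberPart k β) = 0 := by
  have hseries := hasFPowerSeriesAt_zero_of_hasSum (𝕜 := ℂ)
    (f := fun _ => (0 : ℂ)) (c := fun k => inner ℂ φ (numberPart k β)) fun s => by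
      simpa [inner_smul_right, h] using (innerSL ℂ φ).hasSum (hasSum_numberPart s β)
  have hzero := congrFun hseries.eq_zero k
  simpa using congrArg (fun p => p fun _ => 1) hzero

/-- The `k`-photon part of `β ↦ ⟨φ, expVec β⟩`, as a polynomial in `β`. -/
noncomputable def numberPolynomial (φ : Fock M) (k : ℕ) : MvPolynomial (Fin M) ℂ :=
  ∑ n ∈ Finset.univ.piAntidiag k, MvPolynomial.monomial (Finsupp.equivFunOnFinite.symm n)
    (conj (φ n) / ∏ m, (√(n m).factorial : ℝ))

lemma eval_numberPolynomial (φ : Fock M) (k : ℕ) (β : Fin M → ℂ) :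
    MvPolynomial.eval β (numberPolynomial φ k) = inner ℂ φ (numberPart k β) := by
  simp only [numberPolynomial, numberPart, map_sum, inner_sum, inner_smul_right]
  refine Finset.sum_congr rfl fun n _ => ?_
  rw [← inner_conj_symm, inner_ket_left, MvPolynomial.eval_monomial, expVec_apply]
  simp [expCoeff, Finsupp.prod_fintype, Finset.prod_div_distrib]
  ring

lemma coeff_numberPolynomial (φ : Fock M) (n : Fin M → ℕ) :
    (numberPolynomial φ (∑ m, n m)).coeff (Finsupp.equivFunOnFinite.symm n) =
      conj (φ n) / ∏ m, (√(n m).factorial : ℝ) := by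
  simp [numberPolynomial, MvPolynomial.coeff_sum, MvPolynomial.coeff_monomial]

lemma eq_zero_of_inner_expVec {φ : Fock M} (h : ∀ β, inner ℂ φ (expVec β) = 0) : φ = 0 := by
  refine lp.ext <| funext fun n => ?_
  have hpoly : numberPolynomial φ (∑ m, n m) = 0 := MvPolynomial.funext fun β => by
    rw [eval_numberPolynomial, inner_numberPart_eq_zero h, map_zero]
  have hcoeff := coeff_numberPolynomial φ n
  rw [hpoly, MvPolynomial.coeff_zero, eq_comm, div_eq_zero_iff] at hcoeff
  rcases hcoeff with h | h
  · simpa using h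
  · simp [Finset.prod_eq_zero_iff, Nat.factorial_ne_zero] at h

lemma ext_expVec {A B : Fock M →L[ℂ] Fock M} (h : ∀ β, A (expVec β) = B (expVec β)) :
    A = B := by
  have hdense : Dense (Submodule.span ℂ (Set.range (expVec (M := M))) : Set (Fock M)) := by
    rw [Submodule.dense_iff_topologicalClosure_eq_top, Submodule.topologicalClosure_eq_top_iff,
      Submodule.eq_bot_iff]
    exact fun φ hφ => eq_zero_of_inner_expVec fun β =>
      Submodule.inner_left_of_mem_orthogonal (Submodule.subset_span (Set.mem_range_self β)) hφ
  exact ContinuousLinearMap.ext_on hdense (Set.forall_mem_range.mpr h)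

/-- The one-photon vector `∑ₘ βₘ |1ₘ⟩` with a photon in the single-particle state `β`. -/
noncomputable def onePhoton (β : Fin M → ℂ) : Fock M := ∑ m, β m • ket (Pi.single m 1)

lemma piAntidiag_univ_one :
    (Finset.univ.piAntidiag 1 : Finset (Fin M → ℕ)) =
      Finset.univ.image fun m => Pi.single m 1 := by
  ext n
  have h := Finsupp.sum_eq_one_iff (Finsupp.equivFunOnFinite.symm n)
  simpa [Finsupp.sum_fintype, Finsupp.ext_iff, funext_iff, Finsupp.single_apply, Pi.single_apply,
    eq_comm] using h

lemma expVec_apply_single (β : Fin M → ℂ) (m : Fin M) (k : ℕ) :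
    expVec β (Pi.single m k) = expCoeff (β m) k := by
  rw [expVec_apply, Finset.prod_eq_single m] <;> simp +contextual [expCoeff]

lemma expVec_apply_single_one (β : Fin M → ℂ) (m : Fin M) : expVec β (Pi.single m 1) = β m := by
  simp [expVec_apply_single, expCoeff]

lemma numberPart_one (β : Fin M → ℂ) : numberPart 1 β = onePhoton β := by
  rw [numberPart, onePhoton, piAntidiag_univ_one,
    Finset.sum_image fun m _ m' _ h => by simpa [Pi.single_apply] using congrFun h m]
  simp only [expVec_apply_single_one]

lemma hasDerivAt_expVec_smul (β : Fin M → ℂ) :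
    HasDerivAt (fun s : ℂ => expVec (s • β)) (onePhoton β) 0 := by
  simpa [numberPart_one] using (hasFPowerSeriesAt_expVec_smul β).hasDerivAt

end PhotonNumber

section FockLifts

variable {M N K : ℕ}

/-- The isometry `V` of Fock spaces is the second quantization of the matrix `A`: it maps the
exponential vector of `β` to that of `A β`. Multiport beamsplitters and tensoring with vacua are of
this form. -/
structure IsFockLift (A : Matrix (Fin M) (Fin N) ℂ) (V : Fock N →L[ℂ] Fock M) : Prop where
  adjoint_comp_self : V.adjoint ∘L V = 1
  map_expVec (β : Fin N → ℂ) : V (expVec β) = expVec (A *ᵥ β)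

lemma expVec_zero : expVec (0 : Fin M → ℂ) = ket 0 := by
  refine lp.ext <| funext fun n => ?_
  rw [← inner_ket_left n (ket 0), inner_ket, expVec_apply]
  split_ifs with h
  · simp [h, expCoeff]
  · obtain ⟨m, hm⟩ := Function.ne_iff.mp h
    exact Finset.prod_eq_zero (Finset.mem_univ m) (by simp_all [expCoeff])

lemma inner_onePhoton_expVec (β γ : Fin M → ℂ) :
    inner ℂ (onePhoton β) (expVec γ) = star β ⬝ᵥ γ := by
  simp only [onePhoton, sum_inner, inner_smul_left, inner_ket_left, expVec_apply_single_one,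
    dotProduct, Pi.star_apply, starRingEnd_apply]

lemma inner_onePhoton (β γ : Fin M → ℂ) :
    inner ℂ (onePhoton β) (onePhoton γ) = star β ⬝ᵥ γ := by
  have h := (innerSL ℂ (onePhoton β)).hasFDerivAt.comp_hasDerivAt (0 : ℂ) (hasDerivAt_expVec_smul γ)
  simp only [Function.comp_def, innerSL_apply_apply, inner_onePhoton_expVec, dotProduct_smul] at h
  exact h.unique (by simpa using (hasDerivAt_id (0 : ℂ)).smul_const (star β ⬝ᵥ γ))

namespace IsFockLift

variable {A : Matrix (Fin M) (Fin N) ℂ} {V : Fock N →L[ℂ] Fock M}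

lemma map_ket_zero (hV : IsFockLift A V) : V (ket 0) = ket 0 := by
  rw [← expVec_zero, hV.map_expVec, Matrix.mulVec_zero, expVec_zero]

lemma map_onePhoton (hV : IsFockLift A V) (β : Fin N → ℂ) :
    V (onePhoton β) = onePhoton (A *ᵥ β) := by
  have h := V.hasFDerivAt.comp_hasDerivAt (0 : ℂ) (hasDerivAt_expVec_smul β)
  simp only [Function.comp_def, hV.map_expVec, Matrix.mulVec_smul] at h
  exact h.unique (hasDerivAt_expVec_smul (A *ᵥ β))

lemma adjoint_apply_self (hV : IsFockLift A V) (ψ : Fock N) : V.adjoint (V ψ) = ψ :=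
  DFunLike.congr_fun hV.adjoint_comp_self ψ

lemma star_mulVec_dotProduct_mulVec (hV : IsFockLift A V) (β γ : Fin N → ℂ) :
    star (A *ᵥ β) ⬝ᵥ A *ᵥ γ = star β ⬝ᵥ γ := by
  rw [← inner_onePhoton, ← inner_onePhoton, ← hV.map_onePhoton, ← hV.map_onePhoton,
    ← ContinuousLinearMap.adjoint_inner_right, hV.adjoint_apply_self]

lemma comp {B : Matrix (Fin K) (Fin M) ℂ} {W : Fock M →L[ℂ] Fock K} (hW : IsFockLift B W)
    (hV : IsFockLift A V) : IsFockLift (B * A) (W ∘L V) where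
  adjoint_comp_self := by
    ext1 ψ
    simp [ContinuousLinearMap.adjoint_comp, hW.adjoint_apply_self, hV.adjoint_apply_self]
  map_expVec β := by
    rw [ContinuousLinearMap.comp_apply, hV.map_expVec, hW.map_expVec, Matrix.mulVec_mulVec]

lemma adjoint_comp_displacedParity_comp (hV : IsFockLift A V) (α : Fin N → ℂ) :
    V.adjoint ∘L displacedParity (A *ᵥ α) ∘L V = displacedParity α := by
  refine ext_expVec fun β => ?_
  have hpoint : 2 • A *ᵥ α - A *ᵥ β = A *ᵥ (2 • α - β) := by
    rw [Matrix.mulVec_sub, Matrix.mulVec_smul]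
  simp only [ContinuousLinearMap.comp_apply, hV.map_expVec, displacedParity_expVec, map_smul,
    hV.star_mulVec_dotProduct_mulVec, hpoint]
  rw [← hV.map_expVec, hV.adjoint_apply_self]

lemma trace_conj_comp_displacedParity (hV : IsFockLift A V) {ρ : Fock N →L[ℂ] Fock N}
    (hρ : IsState ρ) (α : Fin N → ℂ) :
    trace ((V ∘L ρ ∘L V.adjoint) ∘L displacedParity (A *ᵥ α)) =
      trace (ρ ∘L displacedParity α) := by
  rw [trace_conj_comp hρ, hV.adjoint_comp_displacedParity_comp]

end IsFockLift

lemma isFockLift_bilinearExp (L : Matrix (Fin M) (Fin M) ℂ) (hL : Lᴴ = -L) :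
    IsFockLift (NormedSpace.exp L) (bilinearExp L hL) where
  adjoint_comp_self := adjoint_expOp_comp_self _
  map_expVec := bilinearExp_expVec L hL

lemma expVec_single_apply_eq_zero (b : ℂ) {m : Fin M} {n : Fin M → ℕ}
    (hn : n ∉ Set.range (Pi.single m)) : expVec (Pi.single m b) n = 0 := by
  obtain ⟨i, hi⟩ := Function.ne_iff.mp fun h => hn ⟨n m, h⟩
  have him : i ≠ m := by
    rintro rfl
    simp at hi
  exact Finset.prod_eq_zero (Finset.mem_univ i) (by simp_all [expCoeff, eq_comm])

variable [NeZero M]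

lemma tensorVacuum_ket (n : Fin 1 → ℕ) :
    tensorVacuum M (ket n) = ket (Pi.single (0 : Fin M) (n 0)) := by
  simp [tensorVacuum, ket]

lemma tensorVacuum_expVec (β : Fin 1 → ℂ) :
    tensorVacuum M (expVec β) = expVec (Pi.single 0 (β 0)) := by
  have hinj : Function.Injective fun n : Fin 1 → ℕ => (Pi.single 0 (n 0) : Fin M → ℕ) :=
    (Pi.single_injective 0).comp (Equiv.funUnique (Fin 1) ℕ).injective
  have hright := (hinj.hasSum_iff fun n hn => ?_).mpr
    (hasSum_ket (expVec (Pi.single (0 : Fin M) (β 0))))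
  · refine ((tensorVacuum M).hasSum (hasSum_ket (expVec β))).unique
      (hright.congr_fun fun n => ?_)
    simp only [Function.comp_apply]
    rw [expVec_apply_single, Pi.single_eq_same, map_smul, tensorVacuum_ket, expVec_apply,
      Fin.prod_univ_one]
  · rw [expVec_single_apply_eq_zero, zero_smul]
    rintro ⟨k, rfl⟩
    exact hn ⟨fun _ => k, rfl⟩

lemma isFockLift_tensorVacuum :
    IsFockLift (Matrix.of fun m _ => (Pi.single 0 1 : Fin M → ℂ) m) (tensorVacuum M) where
  adjoint_comp_self := (ContinuousLinearMap.norm_map_iff_adjoint_comp_self _).mp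
    (vacuum_kets_orthonormal M).orthogonalFamily.linearIsometry.norm_map
  map_expVec β := by
    rw [tensorVacuum_expVec]
    congr 1
    ext m
    simp [Matrix.mulVec, dotProduct, Pi.single_apply]

end FockLifts

section OnePhoton

variable {M : ℕ}

lemma trace_pureState_onePhoton_comp_displacedParity (β α : Fin M → ℂ) :
    trace (pureState (onePhoton β) ∘L displacedParity α) =
      Complex.exp (-2 * (star α ⬝ᵥ α)) *
        (4 * (star α ⬝ᵥ β) * (star β ⬝ᵥ α) - star β ⬝ᵥ β) := by
  have hleft := (innerSL ℂ (onePhoton β) ∘L displacedParity α).hasFDerivAt.comp_hasDerivAt (0 : ℂ)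
    (hasDerivAt_expVec_smul β)
  have hexp := (((hasDerivAt_id (0 : ℂ)).mul_const (2 * (star α ⬝ᵥ β))).const_add
    (-2 * (star α ⬝ᵥ α))).cexp
  have hright := hexp.mul (((hasDerivAt_id (0 : ℂ)).mul_const (star β ⬝ᵥ β)).const_sub
    (2 * (star β ⬝ᵥ α)))
  rw [trace_pureState_comp]
  refine (hleft.unique (hright.congr_of_eventuallyEq (.of_forall fun s => ?_))).trans ?_
  · simp only [Function.comp_apply, ContinuousLinearMap.comp_apply, displacedParity_expVec,
      map_smul, innerSL_apply_apply, inner_onePhoton_expVec, dotProduct_sub, two_nsmul,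
      dotProduct_add, dotProduct_smul, smul_eq_mul, id_eq, Pi.mul_apply]
    ring_nf
  · simp only [id_eq, zero_mul, sub_zero, add_zero]
    ring

lemma wState_eq_onePhoton (M : ℕ) :
    wState M = onePhoton fun _ => ((√M : ℝ) : ℂ)⁻¹ := by
  rw [wState, onePhoton, Finset.smul_sum]

lemma ket_one_eq_onePhoton : ket (fun _ : Fin 1 => 1) = onePhoton fun _ => 1 := by
  rw [onePhoton, Fin.sum_univ_one, one_smul]
  congr 1
  ext i
  simp [Subsingleton.elim i 0]

/-- The Wigner function of a single photon in one mode. -/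
noncomputable def onePhotonWigner (α : ℂ) : ℝ :=
  2 / Real.pi * ((4 * ‖α‖ ^ 2 - 1) * Real.exp (-2 * ‖α‖ ^ 2))

lemma wigner_wState [NeZero M] (α : ℂ) :
    wigner (pureState (wState M)) (fun _ => α) =
      ((2 / Real.pi : ℝ) : ℂ) ^ (M - 1) * onePhotonWigner ((√M : ℝ) * α) := by
  have hsqrt : ((√M : ℝ) : ℂ) ≠ 0 := by simp [NeZero.ne M]
  have hsq : ((√M : ℝ) : ℂ) ^ 2 = M := by
    rw [← Complex.ofReal_pow, Real.sq_sqrt (Nat.cast_nonneg M), Complex.ofReal_natCast]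
  have hdot (a b : ℂ) : star (fun _ : Fin M => a) ⬝ᵥ (fun _ => b) =
      ((√M : ℝ) : ℂ) ^ 2 * (conj a * b) := by
    simp [dotProduct, hsq]
  have hαw : ((√M : ℝ) : ℂ) ^ 2 * (conj α * ((√M : ℝ) : ℂ)⁻¹) = (√M : ℝ) * conj α := by
    field_simp
  have hwα : ((√M : ℝ) : ℂ) ^ 2 * (conj ((√M : ℝ) : ℂ)⁻¹ * α) = (√M : ℝ) * α := by
    rw [map_inv₀, Complex.conj_ofReal]
    field_simp
  have hww : ((√M : ℝ) : ℂ) ^ 2 * (conj ((√M : ℝ) : ℂ)⁻¹ * ((√M : ℝ) : ℂ)⁻¹) = 1 := by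
    rw [map_inv₀, Complex.conj_ofReal]
    field_simp
  have hpow : ((2 / Real.pi : ℝ) : ℂ) ^ M =
      ((2 / Real.pi : ℝ) : ℂ) ^ (M - 1) * (2 / Real.pi : ℝ) := by
    rw [← pow_succ, Nat.sub_add_cancel NeZero.one_le]
  rw [wigner, wState_eq_onePhoton, trace_pureState_onePhoton_comp_displacedParity, hdot, hdot,
    hdot, hdot, hαw, hwα, hww, hpow, onePhotonWigner, mul_assoc]
  simp only [norm_mul, Complex.norm_real, Real.norm_eq_abs, mul_pow, sq_abs]
  push_cast
  rw [← Complex.conj_mul']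
  ring_nf

end OnePhoton

section BalancedInterference

variable {M : ℕ}

lemma onePhoton_single (m : Fin M) : onePhoton (Pi.single m 1) = ket (Pi.single m 1) := by
  rw [onePhoton, Finset.sum_eq_single m] <;> simp +contextual

lemma onePhoton_apply_single (β : Fin M → ℂ) (m : Fin M) :
    onePhoton β (Pi.single m 1) = β m := by
  rw [← inner_ket_left, ← onePhoton_single, inner_onePhoton]
  simp

variable [NeZero M] {U : Fock M →L[ℂ] Fock M} {c : Fin M → Fin M → ℂ}
  {A : Matrix (Fin M) (Fin M) ℂ}

lemma IsBalanced.apply_zero (hU : IsBalanced U c) (hA : IsFockLift A U) (m : Fin M) :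
    A m 0 = ((√M : ℝ) : ℂ)⁻¹ := by
  obtain ⟨hdom, h⟩ := hU m (Finsupp.single (Pi.single 0 1) 1)
  have hright : toFock (annFin 0 (Finsupp.single (Pi.single (0 : Fin M) 1) 1)) +
      ∑ m' ∈ Finset.univ.erase 0, c m m' •
        toFock (annFin m' (Finsupp.single (Pi.single (0 : Fin M) 1) 1)) = ket 0 := by
    rw [Finset.sum_eq_zero, annFin_single]
    · simp
    · intro m' hm'
      simp [Finset.ne_of_mem_erase hm']
  have hleft : (annihilation m ⟨_, hdom⟩ : Fock M) 0 = A m 0 := by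
    change ((√((0 : ℕ) + 1) : ℝ) : ℂ) * U (toFock _) (0 + Pi.single m 1) = A m 0
    rw [toFock_single, one_smul, ← onePhoton_single, hA.map_onePhoton, zero_add,
      onePhoton_apply_single]
    simp
  have hvac := congrArg (inner ℂ (ket 0)) (h.trans hright)
  rw [inner_smul_right, ContinuousLinearMap.adjoint_inner_right, hA.map_ket_zero, inner_ket_left,
    hleft, inner_ket, if_pos rfl] at hvac
  exact eq_inv_of_mul_eq_one_right hvac

lemma IsBalanced.isFockLift_comp_tensorVacuum (hU : IsBalanced U c) (hA : IsFockLift A U) :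
    IsFockLift (Matrix.of fun _ _ => ((√M : ℝ) : ℂ)⁻¹) (U ∘L tensorVacuum M) := by
  have hcol : A * Matrix.of (fun m _ => (Pi.single 0 1 : Fin M → ℂ) m) =
      (Matrix.of fun _ _ => ((√M : ℝ) : ℂ)⁻¹ : Matrix (Fin M) (Fin 1) ℂ) := by
    ext m i
    simp [Matrix.mul_apply, Pi.single_apply, hU.apply_zero hA]
  exact hcol ▸ hA.comp isFockLift_tensorVacuum

lemma interfere_eq_conj (U : Fock M →L[ℂ] Fock M) (ρ₁ : Fock 1 →L[ℂ] Fock 1) :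
    interfere U ρ₁ = (U ∘L tensorVacuum M) ∘L ρ₁ ∘L (U ∘L tensorVacuum M).adjoint := by
  rw [interfere, withVacua, ContinuousLinearMap.adjoint_comp]
  rfl

lemma IsBalanced.interfere_ket_one (hU : IsBalanced U c) (hA : IsFockLift A U) :
    interfere U (pureState (ket fun _ => 1)) = pureState (wState M) := by
  rw [interfere_eq_conj, conj_pureState, ket_one_eq_onePhoton,
    (hU.isFockLift_comp_tensorVacuum hA).map_onePhoton, wState_eq_onePhoton]
  congr 2
  ext m
  simp [Matrix.mulVec, dotProduct]

lemma IsBalanced.wigner_interfere (hU : IsBalanced U c) (hA : IsFockLift A U)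
    {ρ₁ : Fock 1 →L[ℂ] Fock 1} (hρ₁ : IsState ρ₁) (α : ℂ) :
    wigner (interfere U ρ₁) (fun _ => α) =
      ((2 / Real.pi : ℝ) : ℂ) ^ (M - 1) * wigner ρ₁ (fun _ => (√M : ℝ) * α) := by
  have hsqrt : ((√M : ℝ) : ℂ) ≠ 0 := by simp [NeZero.ne M]
  have hslice : (fun _ => α) =
      (Matrix.of fun _ _ => ((√M : ℝ) : ℂ)⁻¹ : Matrix (Fin M) (Fin 1) ℂ) *ᵥ
        fun _ => (√M : ℝ) * α := by
    ext m
    simp [Matrix.mulVec, dotProduct, hsqrt]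
  rw [wigner, wigner, interfere_eq_conj, hslice,
    (hU.isFockLift_comp_tensorVacuum hA).trace_conj_comp_displacedParity hρ₁, ← mul_assoc,
    ← pow_add, Nat.sub_add_cancel NeZero.one_le]

end BalancedInterference

section Volume

open MeasureTheory

lemma lintegral_comp_smul {E : Type*} [NormedAddCommGroup E] [NormedSpace ℝ E] [MeasurableSpace E]
    [BorelSpace E] [FiniteDimensional ℝ E] (μ : Measure E) [μ.IsAddHaarMeasure] (f : E → ℝ≥0∞)
    {r : ℝ} (hr : r ≠ 0) :
    ∫⁻ x, f (r • x) ∂μ = ENNReal.ofReal |(r ^ Module.finrank ℝ E)⁻¹| * ∫⁻ x, f x ∂μ := by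
  rw [← smul_eq_mul, ← lintegral_smul_measure, ← Measure.map_addHaar_smul μ hr]
  exact (lintegral_map_equiv f (Homeomorph.smulOfNeZero r hr).toMeasurableEquiv).symm

variable {M : ℕ} [NeZero M]

lemma diagVolume_eq_of_wigner_eq {ρ : Fock M →L[ℂ] Fock M} {g : ℂ → ℂ}
    (h : ∀ α, wigner ρ (fun _ => α) = ((2 / Real.pi : ℝ) : ℂ) ^ (M - 1) * g ((√M : ℝ) * α)) :
    diagVolume ρ = ENNReal.ofReal (1 / M) * ∫⁻ α, ‖g α‖ₑ := by
  have hM : (0 : ℝ) < M := by exact_mod_cast NeZero.pos M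
  have hscale : ∫⁻ α, ‖g ((√M : ℝ) * α)‖ₑ = ENNReal.ofReal (1 / M) * ∫⁻ α, ‖g α‖ₑ := by
    simpa [abs_of_pos hM] using
      lintegral_comp_smul volume (fun α => ‖g α‖ₑ) (Real.sqrt_pos.mpr hM).ne'
  have hnorm : ENNReal.ofReal ((Real.pi / 2) ^ (M - 1)) *
      ‖((2 / Real.pi : ℝ) : ℂ) ^ (M - 1)‖ₑ = 1 := by
    rw [← ofReal_norm, norm_pow, Complex.norm_real, Real.norm_of_nonneg (by positivity),
      ← ENNReal.ofReal_mul (by positivity), ← mul_pow, ← inv_div, inv_mul_cancel₀ (by positivity),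
      one_pow, ENNReal.ofReal_one]
  simp only [diagVolume, absVolume, mul_one, mul_zero, add_zero, Measure.restrict_univ, h,
    enorm_mul]
  rw [lintegral_const_mul' _ _ enorm_ne_top, ← mul_assoc, hnorm, one_mul, hscale]

lemma IsBalanced.diagVolume_interfere {U : Fock M →L[ℂ] Fock M} {c : Fin M → Fin M → ℂ}
    {A : Matrix (Fin M) (Fin M) ℂ} (hU : IsBalanced U c) (hA : IsFockLift A U)
    {ρ₁ : Fock 1 →L[ℂ] Fock 1} (hρ₁ : IsState ρ₁) :
    diagVolume (interfere U ρ₁) =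
      ENNReal.ofReal (1 / M) * ∫⁻ α : ℂ, ‖wigner ρ₁ (fun _ => α)‖ₑ :=
  diagVolume_eq_of_wigner_eq (hU.wigner_interfere hA hρ₁)

end Volume

section OnePhotonVolume

open MeasureTheory Set Filter

lemma hasDerivAt_sq_add_mul_exp (r : ℝ) :
    HasDerivAt (fun r : ℝ => (r ^ 2 + 1 / 4) * Real.exp (-2 * r ^ 2))
      (r * ((1 - 4 * r ^ 2) * Real.exp (-2 * r ^ 2))) r := by
  refine (((hasDerivAt_pow 2 r).add_const (1 / 4)).mul
    ((hasDerivAt_pow 2 r).const_mul (-2)).exp).congr_deriv ?_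
  push_cast
  ring

lemma tendsto_sq_add_mul_exp_atTop :
    Tendsto (fun r : ℝ => (r ^ 2 + 1 / 4) * Real.exp (-2 * r ^ 2)) atTop (nhds 0) := by
  have hsq : Tendsto (fun r : ℝ => 2 * r ^ 2) atTop atTop :=
    (tendsto_pow_atTop two_ne_zero).const_mul_atTop two_pos
  have hlim := (((Real.tendsto_pow_mul_exp_neg_atTop_nhds_zero 1).const_mul (1 / 2)).add
    ((Real.tendsto_pow_mul_exp_neg_atTop_nhds_zero 0).const_mul (1 / 4))).comp hsq
  refine (hlim.congr fun r => ?_).trans (by simp)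
  simp only [Function.comp_apply, pow_one, pow_zero, neg_mul]
  ring

lemma hasDerivAt_sq_add_mul_exp_of_mem_Icc {r : ℝ} (hr : r ∈ Icc 0 (1 / 2)) :
    HasDerivAt (fun r : ℝ => (r ^ 2 + 1 / 4) * Real.exp (-2 * r ^ 2))
      (r * (|4 * r ^ 2 - 1| * Real.exp (-2 * r ^ 2))) r := by
  have hsign : 4 * r ^ 2 - 1 ≤ 0 := by nlinarith [hr.1, hr.2]
  rw [abs_of_nonpos hsign, neg_sub]
  exact hasDerivAt_sq_add_mul_exp r

lemma hasDerivAt_neg_sq_add_mul_exp_of_mem_Ici {r : ℝ} (hr : r ∈ Ici (1 / 2)) :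
    HasDerivAt (fun r : ℝ => -((r ^ 2 + 1 / 4) * Real.exp (-2 * r ^ 2)))
      (r * (|4 * r ^ 2 - 1| * Real.exp (-2 * r ^ 2))) r := by
  have hsign : 0 ≤ 4 * r ^ 2 - 1 := by nlinarith [mem_Ici.mp hr]
  rw [abs_of_nonneg hsign]
  exact (hasDerivAt_sq_add_mul_exp r).fun_neg.congr_deriv (by ring)

lemma integrableOn_and_integral_Ioi_mul_abs_mul_exp :
    IntegrableOn (fun r : ℝ => r * (|4 * r ^ 2 - 1| * Real.exp (-2 * r ^ 2))) (Ioi 0) ∧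
      ∫ r in Ioi (0 : ℝ), r * (|4 * r ^ 2 - 1| * Real.exp (-2 * r ^ 2)) =
        Real.exp (-(1 / 2)) - 1 / 4 := by
  have hnonneg : ∀ r ∈ Ioi (1 / 2 : ℝ), 0 ≤ r * (|4 * r ^ 2 - 1| * Real.exp (-2 * r ^ 2)) := by
    intro r hr
    have hr0 : 0 < r := one_half_pos.trans hr
    positivity
  have hinner : IntervalIntegrable (fun r : ℝ => r * (|4 * r ^ 2 - 1| * Real.exp (-2 * r ^ 2)))
      volume 0 (1 / 2) := Continuous.intervalIntegrable (by fun_prop) _ _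
  have houter := integrableOn_Ioi_deriv_of_nonneg'
    (fun r => hasDerivAt_neg_sq_add_mul_exp_of_mem_Ici) hnonneg tendsto_sq_add_mul_exp_atTop.neg
  have hinner_eq := intervalIntegral.integral_eq_sub_of_hasDerivAt
    (fun r hr => hasDerivAt_sq_add_mul_exp_of_mem_Icc (by rwa [uIcc_of_le (by norm_num)] at hr))
    hinner
  have houter_eq := integral_Ioi_of_hasDerivAt_of_nonneg'
    (fun r => hasDerivAt_neg_sq_add_mul_exp_of_mem_Ici) hnonneg tendsto_sq_add_mul_exp_atTop.neg
  refine ⟨?_, ?_⟩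
  · rw [← Ioc_union_Ioi_eq_Ioi one_half_pos.le]
    exact ((intervalIntegrable_iff_integrableOn_Ioc_of_le one_half_pos.le).mp hinner).union houter
  · rw [← intervalIntegral.integral_interval_add_Ioi' hinner houter, hinner_eq, houter_eq]
    norm_num
    ring

lemma lintegral_enorm_onePhotonWigner :
    ∫⁻ α, ‖(onePhotonWigner α : ℂ)‖ₑ = ENNReal.ofReal (4 / √(Real.exp 1) - 1) := by
  obtain ⟨hint, hval⟩ := integrableOn_and_integral_Ioi_mul_abs_mul_exp
  have hnorm (α : ℂ) : ‖(onePhotonWigner α : ℂ)‖ =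
      2 / Real.pi * (|4 * ‖α‖ ^ 2 - 1| * Real.exp (-2 * ‖α‖ ^ 2)) := by
    rw [Complex.norm_real, onePhotonWigner, norm_mul, norm_mul, Real.norm_of_nonneg (by positivity),
      Real.norm_of_nonneg (Real.exp_nonneg _), Real.norm_eq_abs]
  have hint' : Integrable fun α : ℂ =>
      2 / Real.pi * (|4 * ‖α‖ ^ 2 - 1| * Real.exp (-2 * ‖α‖ ^ 2)) := by
    refine Integrable.const_mul ?_ _
    rw [integrable_fun_norm_addHaar volume
      (f := fun r => |4 * r ^ 2 - 1| * Real.exp (-2 * r ^ 2))]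
    simpa [Complex.finrank_real_complex] using hint
  simp only [← ofReal_norm, hnorm]
  rw [← ofReal_integral_eq_lintegral_ofReal hint' (.of_forall fun α => by positivity),
    integral_const_mul, integral_fun_norm_addHaar volume
      fun r => |4 * r ^ 2 - 1| * Real.exp (-2 * r ^ 2)]
  simp only [Complex.finrank_real_complex, Nat.add_one_sub_one, pow_one, smul_eq_mul, hval,
    Measure.real, Complex.volume_ball]
  rw [← Real.exp_half, Real.exp_neg]
  congr 1
  simp only [ENNReal.ofReal_one, one_pow, one_mul, ENNReal.coe_toReal, NNReal.coe_real_pi,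
    nsmul_eq_mul, Nat.cast_ofNat]
  field_simp
  ring

lemma diagVolume_wState (M : ℕ) [NeZero M] :
    diagVolume (pureState (wState M)) = ENNReal.ofReal (4 / (M * √(Real.exp 1)) - 1 / M) := by
  rw [diagVolume_eq_of_wigner_eq (g := fun α => onePhotonWigner α) wigner_wState,
    lintegral_enorm_onePhotonWigner, ← ENNReal.ofReal_mul (by positivity)]
  congr 1
  field_simp

end OnePhotonVolume

section Threshold

lemma four_div_sqrt_exp_sub_one_mem_Ioo :
    4 / √(Real.exp 1) - 1 ∈ Set.Ioo 1.426 1.4262 := by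
  have hsq : √(Real.exp 1) ^ 2 = Real.exp 1 := Real.sq_sqrt (Real.exp_pos 1).le
  have hpos : 0 < √(Real.exp 1) := Real.sqrt_pos.mpr (Real.exp_pos 1)
  have hgt : 1.6487 < √(Real.exp 1) := by nlinarith [Real.exp_one_gt_d9]
  have hlt : √(Real.exp 1) < 1.6488 := by nlinarith [Real.exp_one_lt_d9]
  refine ⟨?_, ?_⟩
  · rw [lt_sub_iff_add_lt, lt_div_iff₀ hpos]
    linarith
  · rw [sub_lt_iff_lt_add, div_lt_iff₀ hpos]
    linarith

/- Squaring turns the inequality into `M² / (M - 1) < 4κ²` with `κ = 4/√e - 1`, and `4κ² ≈ 8.135`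
lies between `36/5` and `49/6`, the values of `M² / (M - 1)` at `M = 6` and `M = 7`. -/
lemma one_div_two_sqrt_lt_iff {M : ℕ} (hM : 2 ≤ M) :
    1 / (2 * √((M : ℝ) - 1)) < 4 / (M * √(Real.exp 1)) - 1 / M ↔ M ≤ 6 := by
  have hM2 : (2 : ℝ) ≤ M := by exact_mod_cast hM
  have hpred : (0 : ℝ) < M - 1 := by linarith
  have hfactor : 4 / (M * √(Real.exp 1)) - 1 / M = (4 / √(Real.exp 1) - 1) / M := by field_simp
  obtain ⟨hgt, hlt⟩ := four_div_sqrt_exp_sub_one_mem_Ioo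
  rw [hfactor]
  generalize 4 / √(Real.exp 1) - 1 = κ at hgt hlt
  have hκ_lower : 8.133 < 4 * κ ^ 2 := by nlinarith
  have hκ_upper : 4 * κ ^ 2 < 8.137 := by nlinarith
  have hsquare : 1 / (2 * √((M : ℝ) - 1)) < κ / M ↔ (M : ℝ) ^ 2 < 4 * κ ^ 2 * (M - 1) := by
    rw [div_lt_div_iff₀ (by positivity) (by linarith), one_mul,
      ← pow_lt_pow_iff_left₀ (by linarith) (by positivity) two_ne_zero, mul_pow, mul_pow,
      Real.sq_sqrt hpred.le]
    ring_nf
  rw [hsquare]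
  refine ⟨fun h => ?_, fun h => ?_⟩
  · by_contra! hM7
    have hM7' : (7 : ℝ) ≤ M := by exact_mod_cast hM7
    nlinarith
  · interval_cases M <;> push_cast <;> linarith

end Threshold

end BosonicModes

theorem mainTheorem5 :
    (∀ (M : ℕ) [NeZero M] (𝒰 : Matrix.unitaryGroup (Fin M) ℂ) (U : Fock M →L[ℂ] Fock M)
        (c : Fin M → Fin M → ℂ),
      IsMultiportBeamsplitter 𝒰 U → IsBalanced U c →
        (∀ ρ₁ : Fock 1 →L[ℂ] Fock 1, IsState ρ₁ →
          diagVolume (interfere U ρ₁) =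
            ENNReal.ofReal (1 / M) * ∫⁻ α : ℂ, ‖wigner ρ₁ (fun _ => α)‖ₑ) ∧
        interfere U (pureState (ket fun _ => 1)) = pureState (wState M)) ∧
    (∀ M : ℕ, 1 ≤ M →
      diagVolume (pureState (wState M)) =
        ENNReal.ofReal (4 / (M * Real.sqrt (Real.exp 1)) - 1 / M)) ∧
    (∀ M : ℕ, 2 ≤ M →
      (ENNReal.ofReal (1 / (2 * Real.sqrt ((M : ℝ) - 1))) < diagVolume (pureState (wState M)) ↔
        M ≤ 6)) := by
  refine ⟨?_, fun M hM => ?_, fun M hM => ?_⟩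
  · rintro M _ 𝒰 _ c ⟨L, hL, -, rfl⟩ hbalanced
    have hlift := isFockLift_bilinearExp L hL
    exact ⟨fun ρ₁ hρ₁ => hbalanced.diagVolume_interfere hlift hρ₁,
      hbalanced.interfere_ket_one hlift⟩
  · have : NeZero M := ⟨by omega⟩
    exact diagVolume_wState M
  · have : NeZero M := ⟨by omega⟩
    rw [diagVolume_wState, ENNReal.ofReal_lt_ofReal_iff_of_nonneg (by positivity),
      one_div_two_sqrt_lt_iff hM]
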